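/- **Setting.** Let $\mathcal X$ be a set and $\mathcal C\subseteq\{0,1\}^{\mathcal X}$ a nonempty concept class; all distributions are discrete. A randomized algorithm for $n\ge 0$ users with $m$ examples each maps $\mathbf x=(\mathbf x_1,\dots,\mathbf x_n)$, $\mathbf x_i\in(\mathcal X\times\{0,1\})^m$, to a distribution over hypotheses $h:\mathcal X\to\{0,1\}$. It is $\varepsilon$-user-level DP (pure DP, $\delta=0$) if $\Pr[\mathbf A(\mathbf x)\in S]\le e^{\varepsilon}\Pr[\mathbf A(\mathbf x')\in S]$ for every set $S$ of hypotheses and all $\mathbf x,\mathbf x'$ that differ only in the data of one user. For a distribution $\mathcal D$ on $\mathcal X\times\{0,1\}$ let $\mathrm{Err}_{\mathcal D}(h)=\Pr_{(x,y)\sim\mathcal D}[h(x)\ne y]$. Let $n_m^{\mathrm{agn}(\mathcal C;\alpha)}(\varepsilon)$ be the smallest $n$ (or $\infty$) for which there is an $\varepsilon$-user-level DP algorithm that, for every $\mathcal D$, given $nm$ i.i.d. samples from $\mathcal D$, outputs with probability at least $2/3$ a hypothesis $h$ with $\mathrm{Err}_{\mathcal D}(h)\le\inf_{c\in\mathcal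 C}\mathrm{Err}_{\mathcal D}(c)+\alpha$. A distribution $\mathcal P$ on finite concept classes is a $(\tfrac14,\tfrac14)$-probabilistic representation of $\mathcal C$ if for every $c\in\mathcal C$ and every distribution $\mathcal D_{\mathcal X}$ on $\mathcal X$, with probability at least $3/4$ over $\mathcal H\sim\mathcal P$ there is $h\in\mathcal H$ with $\Pr_{x\sim\mathcal D_{\mathcal X}}[c(x)\ne h(x)]\le\tfrac14$. Let $d=d(\mathcal C)\in[0,\infty]$ be the probabilistic representation dimension, i.e. the infimum over such $\mathcal P$ of $\sup_{\mathcal H\in\mathrm{supp}(\mathcal P)}\log|\mathcal H|$ (with $\log 0$ read as $0$), and let $d_{\mathrm{VC}}\in\mathbb N\cup\{\infty\}$ be the VC dimension of $\mathcal C$. **Theorem.** There are absolute constants $\alpha_0,\varepsilon_0,K>0$ and $k\in\mathbb N$ such that for all $\mathcal X$, all nonempty $\mathcal C$, all $0<\alpha\le\alpha_0$, $0<\varepsilon\le\varepsilon_0$ and all integers $m\ge1$, with $$f=\frac d\varepsilon+\frac d{\alpha\varepsilon\sqrt m}+\frac d{\alpha^2m},\qquad g=\frac d\varepsilon+\frac{d_{\mathrm{VC}}}{\alpha\varepsilon\sqrt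 m}+\frac{d_{\mathrm{VC}}}{\alpha^2m},$$ we have $$n_m^{\mathrm{agn}(\mathcal C;\alpha)}(\varepsilon)\ \le\ K\cdot f\cdot\log^k\!\left(3+f+\tfrac1\alpha\right)$$ (that is, at most $\tilde O(f)$), and $$g\ \le\ K\cdot\log^k(3+g)\cdot n_m^{\mathrm{agn}(\mathcal C;\alpha)}(\varepsilon)$$ (that is, $n_m^{\mathrm{agn}(\mathcal C;\alpha)}(\varepsilon)\ge\tilde\Omega(g)$). If $f=\infty$ the first bound is void; if $g=\infty$ the second says that $n_m^{\mathrm{agn}(\mathcal C;\alpha)}(\varepsilon)=\infty$. -/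

import Mathlib

open scoped ENNReal

noncomputable section

namespace UserDP

/-! ### Independent samples -/

theorem tsum_prod_eq_one {Z : Type*} (D : PMF Z) (n : ℕ) :
    ∑' x : Fin n → Z, ∏ i, D (x i) = 1 := by
  induction n with
  | zero => simp
  | succ n ih =>
    rw [← (Fin.consEquiv (fun _ : Fin (n + 1) => Z)).tsum_eq, ENNReal.tsum_prod']
    simp only [Fin.consEquiv_apply, Fin.prod_univ_succ, Fin.cons_zero, Fin.cons_succ]
    simp_rw [ENNReal.tsum_mul_left]
    have h : ∑' b : Fin n → Z, ∏ i, D (b i) = 1 := ih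
    simp [h, D.tsum_coe]

/-- The distribution `D^n` of `n` independent samples from `D`: the tuple `x` has
probability `∏ i, D (x i)`. -/
def iid {Z : Type*} (n : ℕ) (D : PMF Z) : PMF (Fin n → Z) :=
  ⟨fun x => ∏ i, D (x i), by
    rw [← tsum_prod_eq_one D n]; exact ENNReal.summable.hasSum⟩

/-! ### User-level differential privacy and user complexity -/

/-- A randomized algorithm for `n` users with `m` examples each: it maps an input, where `x i j` is
the `j`-th example of user `i`, to the distribution of its output. -/
abbrev Algorithm (n m : ℕ) (Z O : Type*) := (Fin n → Fin m → Z) → PMF O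

/-- User-level neighbors: the inputs agree once the data of some user is removed. -/
def Neighbors {n m : ℕ} {Z : Type*} (x x' : Fin n → Fin m → Z) : Prop :=
  ∃ i, ∀ j, j ≠ i → x j = x' j

/-- `(ε, δ)`-user-level differential privacy. -/
def IsUserLevelDP {n m : ℕ} {Z O : Type*} (A : Algorithm n m Z O) (ε δ : ℝ) : Prop :=
  ∀ x x', Neighbors x x' → ∀ S : Set O,
    (A x).toOuterMeasure S ≤
      ENNReal.ofReal (Real.exp ε) * (A x').toOuterMeasure S + ENNReal.ofReal δ

/-- `A` is `γ`-useful for the task with sets of correct answers `Ψ D`: for every distribution `D`,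
on `n * m` independent samples from `D` the output is correct with probability at least `γ`, over
the randomness of the input and of the algorithm. -/
def IsUseful {n m : ℕ} {Z O : Type*} (A : Algorithm n m Z O) (Ψ : PMF Z → Set O) (γ : ℝ) : Prop :=
  ∀ D : PMF Z, ENNReal.ofReal γ ≤ ((iid n (iid m D)).bind A).toOuterMeasure (Ψ D)

/-- The user complexity: the smallest number `n` of users for which some
`(ε, δ)`-user-level DP algorithm on `m` examples per user is `γ`-useful for the task `Ψ`
(`⊤` if there is no such `n`). -/
def userComplexity {Z O : Type*} (Ψ : PMF Z → Set O) (m : ℕ) (ε δ γ : ℝ) : ℕ∞ :=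
  ⨅ (n : ℕ) (_ : ∃ A : Algorithm n m Z O, IsUserLevelDP A ε δ ∧ IsUseful A Ψ γ), (n : ℕ∞)

/-! ### Agnostic PAC learning -/

/-- The error `Pr_{(x, y) ∼ D} [c x ≠ y]`. -/
def err {X : Type*} (D : PMF (X × Bool)) (c : X → Bool) : ℝ≥0∞ :=
  D.toOuterMeasure {z | c z.1 ≠ z.2}

/-- The task of agnostic learning of `C` up to excess error `α`. -/
def agnostic {X : Type*} (C : Set (X → Bool)) (α : ℝ) (D : PMF (X × Bool)) : Set (X → Bool) :=
  {c | err D c ≤ (⨅ c' ∈ C, err D c') + ENNReal.ofReal α}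

/-! ### Probabilistic representation dimension and VC dimension -/

/-- `P`, a distribution on (finite) concept classes, is an `(α, β)`-probabilistic representation
of `C`. -/
def IsPR {X : Type*} (P : PMF (Finset (X → Bool))) (C : Set (X → Bool)) (α β : ℝ) : Prop :=
  ∀ c ∈ C, ∀ D : PMF X,
    ENNReal.ofReal (1 - β) ≤
      P.toOuterMeasure {H | ∃ h ∈ H, D.toOuterMeasure {x | c x ≠ h x} ≤ ENNReal.ofReal α}

/-- The size of `P`: the maximum of `log |H|` over `H` in the support of `P`. -/
def prSize {X : Type*} (P : PMF (Finset (X → Bool))) : ℝ≥0∞ :=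
  ⨆ H ∈ P.support, ENNReal.ofReal (Real.log (H.card : ℝ))

/-- The `(α, β)`-probabilistic representation dimension. -/
def prDimAt {X : Type*} (C : Set (X → Bool)) (α β : ℝ) : ℝ≥0∞ :=
  ⨅ (P : PMF (Finset (X → Bool))) (_ : IsPR P C α β), prSize P

/-- The probabilistic representation dimension. -/
def prDim {X : Type*} (C : Set (X → Bool)) : ℝ≥0∞ := prDimAt C (1 / 4) (1 / 4)

/-- `C` shatters `S`: every labelling is realized on `S` by a concept of `C`. -/
def Shatters {X : Type*} (C : Set (X → Bool)) (S : Finset X) : Prop :=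
  ∀ f : X → Bool, ∃ c ∈ C, ∀ x ∈ S, c x = f x

/-- The VC dimension: the largest size of a shattered set (`⊤` if unbounded). -/
def vcDim {X : Type*} (C : Set (X → Bool)) : ℕ∞ :=
  ⨆ (S : Finset X) (_ : Shatters C S), (S.card : ℕ∞)

/-! ### Rates -/

/-- `d₁ / ε + d₂ / (α ε √m) + d₂ / (α² m)`. -/
def rate (d₁ d₂ : ℝ≥0∞) (α ε : ℝ) (m : ℕ) : ℝ≥0∞ :=
  d₁ / ENNReal.ofReal ε + d₂ / ENNReal.ofReal (α * ε * √(m : ℝ)) +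
    d₂ / ENNReal.ofReal (α ^ 2 * m)

/-- The logarithmic factor `(log (3 + t))^k`; it is at least `1`. For `t = ⊤` the value
is a positive finite constant. -/
def logFactor (k : ℕ) (t : ℝ≥0∞) : ℝ≥0∞ :=
  ENNReal.ofReal (Real.log (3 + t.toReal) ^ k)

end UserDP

end

open scoped ENNReal

noncomputable section

namespace UserDP

/-! ### Expectations with respect to discrete distributions -/

/-! Upper bound. A probabilistic representation is amplified by boosting: the majority votes over `T
= O(log (1 / α))` independent draws contain, with probability at least 11/12, a hypothesis `α /
4`-close to any fixed concept, while the log-size grows only to `4 * d * T` (`boosted_compl_le`,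
`exists_representation`). From such a class the exponential mechanism selects a hypothesis. Each
user votes on a pair `h, h'` with the average loss difference over the user's `m` examples, clipped
to `[-B, B]` with `B ≈ α + log (1 / α) / √m`. This average fluctuates on the scale `1 / √m`, so the
clipping hardly hurts (`mean_clip_average_le`), and one user moves a score by at most `2 * B`.
Privacy then costs `log |H| * B / (α * ε)` users and concentration `log |H| * B ^ 2 / α ^ 2`, which
is the rate up to logarithms (`select_bad_le`, `quotient_le`).

Lower bound, three separate terms. The term `d / ε`: by group privacy the output distribution on one
fixed input gives mass at least `(2 / 3) * exp (-ε * n)` to the good hypotheses of every realizable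
problem, so `O(exp (ε * n))` draws from it form a representation (`prDim_le_of_useful`). The term in
`α * ε * √m`: label a shattered set with noisy bias `20 * α`. The data of one user has chi-square
divergence about `m * α ^ 2` from pure noise, so a function varying by a factor `exp ε` in that data
changes in mean by a factor at most `exp (O(ε * α * √m))` (`ChiSqLE.expect_le_exp`). Over `n` users
the output is compared with its law under pure noise, and a packing count over all labellings
concludes (`card_le_of_private`). The term in `α ^ 2 * m` is the statistical bound for `n * m`
samples, by Assouad's method on the same noisy problems (`card_le_of_useful`). -/

/-- The expectation of a nonnegative extended-real function. -/
def expect {Ω : Type*} (p : PMF Ω) (F : Ω → ℝ≥0∞) : ℝ≥0∞ := ∑' x, p x * F x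

section Expect

variable {Ω Ω' : Type*}

theorem expect_mono {p : PMF Ω} {F G : Ω → ℝ≥0∞} (h : ∀ x, F x ≤ G x) :
    expect p F ≤ expect p G :=
  ENNReal.tsum_le_tsum fun x => mul_le_mul_right (h x) _

theorem expect_mono_support {p : PMF Ω} {F G : Ω → ℝ≥0∞} (h : ∀ x ∈ p.support, F x ≤ G x) :
    expect p F ≤ expect p G := by
  refine ENNReal.tsum_le_tsum fun x => ?_
  by_cases hx : p x = 0
  · simp [hx]
  · exact mul_le_mul_right (h x ((p.mem_support_iff x).2 hx)) _

theorem expect_const (p : PMF Ω) (c : ℝ≥0∞) : expect p (fun _ => c) = c := by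
  simp [expect, ENNReal.tsum_mul_right, p.tsum_coe]

theorem expect_add (p : PMF Ω) (F G : Ω → ℝ≥0∞) :
    expect p (fun x => F x + G x) = expect p F + expect p G := by
  simp [expect, mul_add, ENNReal.tsum_add]

theorem expect_const_mul (p : PMF Ω) (c : ℝ≥0∞) (F : Ω → ℝ≥0∞) :
    expect p (fun x => c * F x) = c * expect p F := by
  simp only [expect, ← ENNReal.tsum_mul_left]
  exact tsum_congr fun x => by ring

theorem expect_sum {ι : Type*} (p : PMF Ω) (s : Finset ι) (F : ι → Ω → ℝ≥0∞) :
    expect p (fun x => ∑ i ∈ s, F i x) = ∑ i ∈ s, expect p (F i) := by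
  simp only [expect, Finset.mul_sum]
  exact Summable.tsum_finsetSum fun _ _ => ENNReal.summable

theorem expect_pure (a : Ω) (F : Ω → ℝ≥0∞) : expect (PMF.pure a) F = F a := by
  rw [expect, tsum_eq_single a]
  · simp
  · intro b hb
    simp [PMF.pure_apply, hb]

theorem expect_bind (p : PMF Ω) (f : Ω → PMF Ω') (F : Ω' → ℝ≥0∞) :
    expect (p.bind f) F = expect p fun x => expect (f x) F := by
  simp only [expect, PMF.bind_apply, ← ENNReal.tsum_mul_right, ← ENNReal.tsum_mul_left]
  rw [ENNReal.tsum_comm]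
  exact tsum_congr fun x => tsum_congr fun y => by ring

theorem expect_map (p : PMF Ω) (f : Ω → Ω') (F : Ω' → ℝ≥0∞) :
    expect (p.map f) F = expect p fun x => F (f x) := by
  rw [← PMF.bind_pure_comp, expect_bind]
  simp [expect_pure]

theorem expect_comm (p : PMF Ω) (q : PMF Ω') (F : Ω → Ω' → ℝ≥0∞) :
    (expect p fun x => expect q fun y => F x y) = expect q fun y => expect p fun x => F x y := by
  simp only [expect, ← ENNReal.tsum_mul_left]
  rw [ENNReal.tsum_comm]
  exact tsum_congr fun x => tsum_congr fun y => by ring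

theorem toOuterMeasure_eq_expect (p : PMF Ω) (S : Set Ω) :
    p.toOuterMeasure S = expect p (S.indicator 1) := by
  rw [PMF.toOuterMeasure_apply, expect]
  refine tsum_congr fun x => ?_
  by_cases hx : x ∈ S <;> simp [hx]

theorem toOuterMeasure_le_one (p : PMF Ω) (S : Set Ω) : p.toOuterMeasure S ≤ 1 := by
  rw [toOuterMeasure_eq_expect]
  calc expect p (S.indicator 1) ≤ expect p fun _ => 1 :=
        expect_mono fun x => Set.indicator_le_self' (fun _ _ => zero_le) x
    _ = 1 := expect_const p 1

theorem toOuterMeasure_add_compl (p : PMF Ω) (S : Set Ω) :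
    p.toOuterMeasure S + p.toOuterMeasure Sᶜ = 1 := by
  rw [toOuterMeasure_eq_expect, toOuterMeasure_eq_expect, ← expect_add]
  rw [← expect_const p 1]
  congr 1
  funext x
  by_cases hx : x ∈ S <;> simp [hx]

theorem toOuterMeasure_compl (p : PMF Ω) (S : Set Ω) :
    p.toOuterMeasure Sᶜ = 1 - p.toOuterMeasure S := by
  rw [← toOuterMeasure_add_compl p S, ENNReal.add_sub_cancel_left]
  exact ((toOuterMeasure_le_one p S).trans_lt ENNReal.one_lt_top).ne

theorem toOuterMeasure_bind_eq_expect (p : PMF Ω) (f : Ω → PMF Ω') (S : Set Ω') :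
    (p.bind f).toOuterMeasure S = expect p fun x => (f x).toOuterMeasure S := by
  rw [PMF.toOuterMeasure_bind_apply, expect]

/-- Markov's inequality, in the form behind both the boosting and the Chernoff bound. -/
theorem toOuterMeasure_le_expect {p : PMF Ω} {S : Set Ω} {F : Ω → ℝ≥0∞}
    (h : ∀ x ∈ S, 1 ≤ F x) : p.toOuterMeasure S ≤ expect p F := by
  rw [toOuterMeasure_eq_expect]
  refine expect_mono fun x => ?_
  by_cases hx : x ∈ S
  · simpa [hx] using h x hx
  · simp [hx]

/-! ### Independent samples -/

theorem expect_iid_zero (D : PMF Ω) (F : (Fin 0 → Ω) → ℝ≥0∞) :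
    expect (iid 0 D) F = F Fin.elim0 := by
  rw [expect, tsum_eq_single Fin.elim0]
  · change (∏ i : Fin 0, D (Fin.elim0 i)) * _ = _
    simp
  · intro b hb
    exact absurd (Subsingleton.elim _ _) hb

theorem expect_iid_succ (n : ℕ) (D : PMF Ω) (F : (Fin (n + 1) → Ω) → ℝ≥0∞) :
    expect (iid (n + 1) D) F =
      expect D fun z => expect (iid n D) fun t => F (Fin.cons z t) := by
  simp only [expect]
  rw [← (Fin.consEquiv (fun _ : Fin (n + 1) => Ω)).tsum_eq, ENNReal.tsum_prod']
  simp_rw [← ENNReal.tsum_mul_left]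
  refine tsum_congr fun z => tsum_congr fun t => ?_
  change (∏ i, D ((Fin.cons z t : Fin (n + 1) → Ω) i)) * _ = D z * ((∏ i, D (t i)) * _)
  simp [Fin.prod_univ_succ, mul_assoc, Fin.consEquiv]

theorem expect_iid_prod (n : ℕ) (D : PMF Ω) (F : Fin n → Ω → ℝ≥0∞) :
    (expect (iid n D) fun x => ∏ i, F i (x i)) = ∏ i, expect D (F i) := by
  induction n with
  | zero => simp [expect_iid_zero]
  | succ n ih =>
    rw [expect_iid_succ, Fin.prod_univ_succ]
    simp only [Fin.prod_univ_succ, Fin.cons_zero, Fin.cons_succ, expect_const_mul]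
    rw [ih fun i => F i.succ]
    simp_rw [mul_comm (F 0 _)]
    rw [expect_const_mul, mul_comm]

theorem expect_iid_apply (n : ℕ) (D : PMF Ω) (F : Ω → ℝ≥0∞) (j : Fin n) :
    (expect (iid n D) fun x => F (x j)) = expect D F := by
  have h := expect_iid_prod n D fun i => if i = j then F else fun _ => 1
  have h1 : ∀ x : Fin n → Ω, ∏ i, (if i = j then F else fun _ => 1) (x i) = F (x j) := by
    intro x
    rw [Finset.prod_eq_single j]
    · simp
    · intro i _ hi
      simp [hi]
    · simp
  simp only [h1] at h
  rw [h, Finset.prod_eq_single j]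
  · simp
  · intro i _ hi
    simp [hi, expect_const]
  · simp

end Expect

/-! ### Real expectations of bounded functions -/

/-- The expectation of a (bounded) real function. -/
def mean {Ω : Type*} (p : PMF Ω) (f : Ω → ℝ) : ℝ := ∑' x, (p x).toReal * f x

/-- Boundedness of a real function. -/
def IsBdd {Ω : Type*} (f : Ω → ℝ) : Prop := ∃ M, ∀ x, |f x| ≤ M

section Mean

variable {Ω Ω' : Type*} {f g : Ω → ℝ}

theorem isBdd_const (c : ℝ) : IsBdd (fun _ : Ω => c) := ⟨|c|, fun _ => le_rfl⟩

theorem IsBdd.add (hf : IsBdd f) (hg : IsBdd g) : IsBdd fun x => f x + g x := by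
  obtain ⟨M, hM⟩ := hf
  obtain ⟨N, hN⟩ := hg
  exact ⟨M + N, fun x => (abs_add_le _ _).trans (add_le_add (hM x) (hN x))⟩

theorem IsBdd.mul (hf : IsBdd f) (hg : IsBdd g) : IsBdd fun x => f x * g x := by
  obtain ⟨M, hM⟩ := hf
  obtain ⟨N, hN⟩ := hg
  refine ⟨M * N, fun x => ?_⟩
  rw [abs_mul]
  exact mul_le_mul (hM x) (hN x) (abs_nonneg _) ((abs_nonneg _).trans (hM x))

theorem IsBdd.sub (hf : IsBdd f) (hg : IsBdd g) : IsBdd fun x => f x - g x := by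
  have h := hf.add ((isBdd_const (-1)).mul hg)
  simpa [sub_eq_add_neg] using h

theorem IsBdd.pow (hf : IsBdd f) (k : ℕ) : IsBdd fun x => f x ^ k := by
  obtain ⟨M, hM⟩ := hf
  exact ⟨M ^ k, fun x => by rw [abs_pow]; exact pow_le_pow_left₀ (abs_nonneg _) (hM x) k⟩

theorem IsBdd.sum {ι : Type*} (s : Finset ι) {F : ι → Ω → ℝ} (h : ∀ i ∈ s, IsBdd (F i)) :
    IsBdd fun x => ∑ i ∈ s, F i x := by
  classical
  induction s using Finset.induction_on with
  | empty => simpa using isBdd_const (Ω := Ω) 0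
  | insert a s ha ih =>
    simp only [Finset.sum_insert ha]
    exact (h a (Finset.mem_insert_self a s)).add
      (ih fun i hi => h i (Finset.mem_insert_of_mem hi))

theorem isBdd_of_mem_Icc {a b : ℝ} (h : ∀ x, a ≤ f x ∧ f x ≤ b) : IsBdd f :=
  ⟨max |a| |b|, fun x => abs_le_max_abs_abs (h x).1 (h x).2⟩

theorem summable_toReal (p : PMF Ω) : Summable fun x => (p x).toReal :=
  ENNReal.summable_toReal p.tsum_coe_ne_top

theorem summable_mean (p : PMF Ω) (hf : IsBdd f) : Summable fun x => (p x).toReal * f x := by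
  obtain ⟨M, hM⟩ := hf
  refine Summable.of_norm_bounded ((summable_toReal p).mul_right M) fun x => ?_
  rw [Real.norm_eq_abs, abs_mul, abs_of_nonneg ENNReal.toReal_nonneg]
  exact mul_le_mul_of_nonneg_left (hM x) ENNReal.toReal_nonneg

theorem mean_const (p : PMF Ω) (c : ℝ) : mean p (fun _ => c) = c := by
  rw [mean, tsum_mul_right, ← ENNReal.tsum_toReal_eq (fun x => p.apply_ne_top x), p.tsum_coe]
  simp

theorem mean_add (p : PMF Ω) (hf : IsBdd f) (hg : IsBdd g) :
    mean p (fun x => f x + g x) = mean p f + mean p g := by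
  simp only [mean, mul_add]
  exact (summable_mean p hf).tsum_add (summable_mean p hg)

theorem mean_const_mul (p : PMF Ω) (c : ℝ) (f : Ω → ℝ) :
    mean p (fun x => c * f x) = c * mean p f := by
  simp only [mean, ← tsum_mul_left]
  exact tsum_congr fun x => by ring

theorem mean_sub (p : PMF Ω) (hf : IsBdd f) (hg : IsBdd g) :
    mean p (fun x => f x - g x) = mean p f - mean p g := by
  simp only [mean, mul_sub]
  exact (summable_mean p hf).tsum_sub (summable_mean p hg)

theorem mean_sum {ι : Type*} (p : PMF Ω) (s : Finset ι) {F : ι → Ω → ℝ}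
    (h : ∀ i ∈ s, IsBdd (F i)) :
    mean p (fun x => ∑ i ∈ s, F i x) = ∑ i ∈ s, mean p (F i) := by
  simp only [mean, Finset.mul_sum]
  exact Summable.tsum_finsetSum fun i hi => summable_mean p (h i hi)

theorem mean_mono (p : PMF Ω) (hf : IsBdd f) (hg : IsBdd g) (h : ∀ x, f x ≤ g x) :
    mean p f ≤ mean p g :=
  Summable.tsum_le_tsum (fun x => mul_le_mul_of_nonneg_left (h x) ENNReal.toReal_nonneg)
    (summable_mean p hf) (summable_mean p hg)

theorem mean_nonneg (p : PMF Ω) (h : ∀ x, 0 ≤ f x) : 0 ≤ mean p f :=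
  tsum_nonneg fun x => mul_nonneg ENNReal.toReal_nonneg (h x)

theorem expect_ofReal (p : PMF Ω) (hf : IsBdd f) (h : ∀ x, 0 ≤ f x) :
    (expect p fun x => ENNReal.ofReal (f x)) = ENNReal.ofReal (mean p f) := by
  rw [mean, ENNReal.ofReal_tsum_of_nonneg
    (fun x => mul_nonneg ENNReal.toReal_nonneg (h x)) (summable_mean p hf), expect]
  refine tsum_congr fun x => ?_
  rw [ENNReal.ofReal_mul ENNReal.toReal_nonneg, ENNReal.ofReal_toReal (p.apply_ne_top x)]

/-- Adding the bound `M` makes `f` nonnegative, so identities between extended expectations transfer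
to real means. -/
theorem mean_eq_of_expect {p : PMF Ω} {q : PMF Ω'} (φ : Ω → Ω')
    (h : ∀ F : Ω' → ℝ≥0∞, (expect p fun x => F (φ x)) = expect q F) {f : Ω' → ℝ}
    (hf : IsBdd f) : mean p (fun x => f (φ x)) = mean q f := by
  obtain ⟨M, hM⟩ := hf
  have hf' : IsBdd f := ⟨M, hM⟩
  have hφ : IsBdd fun x => f (φ x) := ⟨M, fun x => hM _⟩
  have hn : ∀ y, 0 ≤ f y + M := fun y => by linarith [(abs_le.1 (hM y)).1]
  have h1 := h fun y => ENNReal.ofReal (f y + M)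
  rw [expect_ofReal p (hφ.add (isBdd_const M)) (fun x => hn _),
    expect_ofReal q (hf'.add (isBdd_const M)) hn,
    ENNReal.ofReal_eq_ofReal_iff (mean_nonneg p fun x => hn _) (mean_nonneg q hn),
    mean_add p hφ (isBdd_const M), mean_add q hf' (isBdd_const M), mean_const, mean_const] at h1
  linarith

theorem mean_iid_apply (n : ℕ) (D : PMF Ω) (hf : IsBdd f) (j : Fin n) :
    mean (iid n D) (fun x => f (x j)) = mean D f :=
  mean_eq_of_expect (fun x : Fin n → Ω => x j) (fun F => expect_iid_apply n D F j) hf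

end Mean

/-! ### Privacy: hybrid arguments -/

section Privacy

variable {Ω O Z : Type*}

/-- If `p` and `q` are within a factor `κ` on all functions that vary by at most a factor `c`,
then their `n`-fold powers are within `κ ^ n` on functions varying by at most a factor `c` in each
coordinate. -/
theorem expect_iid_le_pow {p q : PMF Ω} {c κ : ℝ≥0∞}
    (h : ∀ F : Ω → ℝ≥0∞, (∀ w w', F w ≤ c * F w') → expect p F ≤ κ * expect q F) :
    ∀ (n : ℕ) (f : (Fin n → Ω) → ℝ≥0∞),
      (∀ x x' : Fin n → Ω, (∃ i, ∀ j, j ≠ i → x j = x' j) → f x ≤ c * f x') →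
      expect (iid n p) f ≤ κ ^ n * expect (iid n q) f
  | 0, f, _ => by simp [expect_iid_zero]
  | n + 1, f, hf => by
    rw [expect_iid_succ, expect_iid_succ]
    have h1 : ∀ z, (expect (iid n p) fun t => f (Fin.cons z t)) ≤
        κ ^ n * expect (iid n q) fun t => f (Fin.cons z t) := fun z => by
      refine expect_iid_le_pow h n _ fun x x' ⟨i, hi⟩ => hf _ _ ⟨i.succ, fun j => ?_⟩
      refine Fin.cases (fun _ => by simp) (fun j hj => ?_) j
      simpa using hi j fun hji => hj (by rw [hji])
    -- Averaging over the tail preserves the factor-`c` variation in the head, so the head can be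
    -- exchanged last.
    have h2 : (expect p fun z => expect (iid n q) fun t => f (Fin.cons z t)) ≤
        κ * expect q fun z => expect (iid n q) fun t => f (Fin.cons z t) := by
      refine h _ fun w w' => ?_
      rw [← expect_const_mul]
      refine expect_mono fun t => hf _ _ ⟨0, fun j => ?_⟩
      refine Fin.cases (fun h0 => absurd rfl h0) (fun j _ => by simp) j
    calc _ ≤ expect p fun z => κ ^ n * expect (iid n q) fun t => f (Fin.cons z t) :=
          expect_mono h1
      _ = κ ^ n * expect p fun z => expect (iid n q) fun t => f (Fin.cons z t) :=
          expect_const_mul _ _ _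
      _ ≤ κ ^ n * (κ * expect q fun z => expect (iid n q) fun t => f (Fin.cons z t)) := by gcongr
      _ = _ := by rw [pow_succ, mul_assoc]

theorem IsUserLevelDP.le_mul {n m : ℕ} {A : Algorithm n m Z O} {ε : ℝ}
    (hA : IsUserLevelDP A ε 0) {x x' : Fin n → Fin m → Z} (h : Neighbors x x') (S : Set O) :
    (A x).toOuterMeasure S ≤ ENNReal.ofReal (Real.exp ε) * (A x').toOuterMeasure S := by
  simpa using hA x x' h S

theorem iid_pure (n : ℕ) (w : Ω) (f : (Fin n → Ω) → ℝ≥0∞) :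
    expect (iid n (PMF.pure w)) f = f fun _ => w := by
  induction n with
  | zero =>
    rw [expect_iid_zero]
    congr 1
    exact Subsingleton.elim _ _
  | succ n ih =>
    rw [expect_iid_succ, expect_pure, ih]
    congr 1
    funext j
    refine Fin.cases ?_ (fun j => ?_) j <;> simp

/-- Group privacy, for an average over inputs against a fixed constant input. -/
theorem IsUserLevelDP.group {n m : ℕ} {A : Algorithm n m Z O} {ε : ℝ}
    (hA : IsUserLevelDP A ε 0) (p : PMF (Fin m → Z)) (w : Fin m → Z) (S : Set O) :
    ((iid n p).bind A).toOuterMeasure S ≤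
      ENNReal.ofReal (Real.exp (ε * n)) * (A fun _ => w).toOuterMeasure S := by
  rw [toOuterMeasure_bind_eq_expect]
  have h := expect_iid_le_pow (p := p) (q := PMF.pure w) (c := ENNReal.ofReal (Real.exp ε))
    (κ := ENNReal.ofReal (Real.exp ε)) (fun F hF => by
      rw [expect_pure]
      calc expect p F ≤ expect p fun _ => ENNReal.ofReal (Real.exp ε) * F w :=
            expect_mono fun x => hF x w
        _ = _ := expect_const _ _) n (fun x => (A x).toOuterMeasure S)
    (fun x x' hx => hA.le_mul hx S)
  rw [iid_pure] at h
  rw [mul_comm ε, Real.exp_nat_mul, ENNReal.ofReal_pow (Real.exp_pos _).le]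
  exact h

end Privacy

/-! ### The lower bound by the representation dimension -/

section Representation

variable {X : Type*} {C : Set (X → Bool)}

/-- The distribution of labelled examples of the concept `c`. -/
def labelled (c : X → Bool) (D : PMF X) : PMF (X × Bool) := D.map fun x => (x, c x)

theorem err_labelled (c h : X → Bool) (D : PMF X) :
    err (labelled c D) h = D.toOuterMeasure {x | c x ≠ h x} := by
  rw [err, labelled, PMF.toOuterMeasure_map_apply]
  congr 1
  ext x
  simp [eq_comm]

theorem mem_agnostic_labelled {c h : X → Bool} (hc : c ∈ C) {D : PMF X} {α : ℝ} :
    h ∈ agnostic C α (labelled c D) ↔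
      D.toOuterMeasure {x | c x ≠ h x} ≤ ENNReal.ofReal α := by
  have h0 : (⨅ c' ∈ C, err (labelled c D) c') = 0 := by
    refine le_antisymm (iInf₂_le_of_le c hc ?_) zero_le
    rw [err_labelled]
    simp
  rw [agnostic, Set.mem_ofPred_eq, h0, zero_add, err_labelled]

/-- Put all mass on a point where the concepts differ. On the input labelled by `c₂`, the output
predicts `c₁ x` with probability at most 1/3, but by group privacy at least `(2 / 3) * exp (-ε *
n)`. The resulting `exp (ε * n) ≥ 2` lets later constants be absorbed into the exponent. -/
theorem log_two_le_of_useful {n m : ℕ} {A : Algorithm n m (X × Bool) (X → Bool)} {α ε : ℝ}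
    (hα : α < 1) (hA : IsUserLevelDP A ε 0)
    (hU : IsUseful A (agnostic C α) (2 / 3)) {c₁ c₂ : X → Bool} (h₁ : c₁ ∈ C) (h₂ : c₂ ∈ C)
    (hne : c₁ ≠ c₂) : Real.log 2 ≤ ε * n := by
  obtain ⟨x, hx⟩ := Function.ne_iff.1 hne
  have key : ∀ c ∈ C, ENNReal.ofReal (2 / 3) ≤
      ENNReal.ofReal (Real.exp (ε * n)) *
        (A fun _ _ => (x, c₂ x)).toOuterMeasure {h | h x = c x} := by
    intro c hc
    refine (hU (labelled c (PMF.pure x))).trans ?_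
    refine le_trans ?_ (hA.group (iid m (labelled c (PMF.pure x))) (fun _ => (x, c₂ x)) _)
    refine MeasureTheory.measure_mono fun h hh => ?_
    rw [mem_agnostic_labelled hc] at hh
    by_contra hcon
    have hcon' : c x ≠ h x := fun h' => hcon h'.symm
    rw [PMF.toOuterMeasure_pure_apply, if_pos (by simpa using hcon')] at hh
    rw [ENNReal.one_le_ofReal] at hh
    linarith
  have k2 : ENNReal.ofReal (2 / 3) ≤
      (A fun _ _ => (x, c₂ x)).toOuterMeasure {h | h x = c₂ x} := by
    refine (hU (labelled c₂ (PMF.pure x))).trans ?_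
    have : labelled c₂ (PMF.pure x) = PMF.pure (x, c₂ x) := by
      rw [labelled, PMF.pure_map]
    rw [this, toOuterMeasure_bind_eq_expect]
    have hm : iid m (PMF.pure (x, c₂ x)) = PMF.pure fun _ => (x, c₂ x) := by
      ext y
      have := iid_pure m (x, c₂ x) (Set.indicator {y} 1)
      rw [← toOuterMeasure_eq_expect, PMF.toOuterMeasure_apply_singleton] at this
      rw [this, PMF.pure_apply]
      by_cases hy : y = fun _ => (x, c₂ x)
      · simp [hy]
      · simp [hy, Ne.symm hy]
    rw [hm, iid_pure]
    refine MeasureTheory.measure_mono fun h hh => ?_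
    rw [← this, mem_agnostic_labelled h₂] at hh
    by_contra hcon
    have hcon' : c₂ x ≠ h x := fun h' => hcon h'.symm
    rw [PMF.toOuterMeasure_pure_apply, if_pos (by simpa using hcon')] at hh
    rw [ENNReal.one_le_ofReal] at hh
    linarith
  have k1 := key c₁ h₁
  set q := A fun _ _ => (x, c₂ x)
  have hdis : q.toOuterMeasure {h | h x = c₁ x} ≤ ENNReal.ofReal (1 / 3) := by
    have hle : q.toOuterMeasure {h | h x = c₁ x} ≤ q.toOuterMeasure {h | h x = c₂ x}ᶜ := by
      refine MeasureTheory.measure_mono fun h hh => ?_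
      simp only [Set.mem_ofPred_eq, Set.mem_compl_iff] at hh ⊢
      rw [hh]
      exact hx
    refine hle.trans ?_
    rw [toOuterMeasure_compl, tsub_le_iff_right]
    refine le_trans ?_ (add_le_add_right k2 _)
    rw [← ENNReal.ofReal_add (by norm_num) (by norm_num)]
    norm_num
  have k3 := k1.trans (mul_le_mul_right hdis _)
  rw [← ENNReal.ofReal_mul (Real.exp_pos _).le, ENNReal.ofReal_le_ofReal_iff (by positivity)] at k3
  rw [Real.log_le_iff_le_exp (by norm_num)]
  linarith

-- The representation is the set of `N` independent outputs on one constant input. Group privacy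
-- makes each draw good with probability at least `2 / (3 * E)`, uniformly over concepts and
-- distributions.
open Classical in
theorem prDim_le_of_useful {n m : ℕ} {A : Algorithm n m (X × Bool) (X → Bool)} {α ε : ℝ}
    (hα : α ≤ 1 / 4) (hA : IsUserLevelDP A ε 0)
    (hU : IsUseful A (agnostic C α) (2 / 3)) {c₁ c₂ : X → Bool} (h₁ : c₁ ∈ C) (h₂ : c₂ ∈ C)
    (hne : c₁ ≠ c₂) : prDim C ≤ ENNReal.ofReal (3 * (ε * n)) := by
  have hlog := log_two_le_of_useful (by linarith) hA hU h₁ h₂ hne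
  obtain ⟨x, hx⟩ := Function.ne_iff.1 hne
  set E := Real.exp (ε * n) with hE
  have hE2 : 2 ≤ E := by
    rw [hE, ← Real.log_le_iff_le_exp (by norm_num)]
    exact hlog
  set N := ⌈3 * E⌉₊ with hN
  set q := A fun _ _ => (x, true) with hq
  set P : PMF (Finset (X → Bool)) := (iid N q).map fun t => Finset.univ.image t with hP
  refine iInf₂_le_of_le P ?_ ?_
  · intro c hc D
    set G : Set (X → Bool) := {h | D.toOuterMeasure {x | c x ≠ h x} ≤ ENNReal.ofReal (1 / 4)}
    have hG : ENNReal.ofReal (2 / (3 * E)) ≤ q.toOuterMeasure G := by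
      have k := (hU (labelled c D)).trans (hA.group (iid m (labelled c D)) (fun _ => (x, true)) _)
      have k' : ENNReal.ofReal (2 / 3) ≤ ENNReal.ofReal E * q.toOuterMeasure G := by
        refine k.trans (mul_le_mul_right (MeasureTheory.measure_mono fun h hh => ?_) _)
        rw [mem_agnostic_labelled hc] at hh
        exact hh.trans (ENNReal.ofReal_le_ofReal hα)
      have hEne : ENNReal.ofReal E ≠ 0 := by
        rw [Ne, ENNReal.ofReal_eq_zero]; linarith
      rw [← ENNReal.mul_le_mul_iff_right hEne ENNReal.ofReal_ne_top, ← ENNReal.ofReal_mul (by linarith)]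
      refine le_trans (le_of_eq ?_) k'
      congr 1
      field_simp
    set b := q.toOuterMeasure Gᶜ with hb
    have hbad : P.toOuterMeasure
        {H | ∃ h ∈ H, D.toOuterMeasure {x | c x ≠ h x} ≤ ENNReal.ofReal (1 / 4)}ᶜ ≤ b ^ N := by
      rw [toOuterMeasure_eq_expect, hP, expect_map]
      have : b ^ N = ∏ _i : Fin N, expect q (Gᶜ.indicator 1) := by
        simp [hb, toOuterMeasure_eq_expect]
      rw [this, ← expect_iid_prod]
      refine expect_mono fun t => ?_
      by_cases ht : ∃ i, t i ∈ G
      · rw [Set.indicator_of_notMem]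
        · exact zero_le
        · obtain ⟨i, hi⟩ := ht
          simp only [Set.mem_compl_iff, not_not]
          exact ⟨t i, Finset.mem_image_of_mem t (Finset.mem_univ i), hi⟩
      · push Not at ht
        have : ∏ i, Gᶜ.indicator (1 : (X → Bool) → ℝ≥0∞) (t i) = 1 :=
          Finset.prod_eq_one fun i _ => by rw [Set.indicator_of_mem (ht i)]; rfl
        rw [this]
        exact Set.indicator_le_self' (fun _ _ => zero_le) _
    have hb1 : b ≤ ENNReal.ofReal (Real.exp (-(2 / (3 * E)))) := by
      rw [hb, toOuterMeasure_compl]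
      calc 1 - q.toOuterMeasure G ≤ 1 - ENNReal.ofReal (2 / (3 * E)) := tsub_le_tsub_left hG _
        _ = ENNReal.ofReal (1 - 2 / (3 * E)) := by
          rw [ENNReal.ofReal_sub _ (by positivity), ENNReal.ofReal_one]
        _ ≤ _ := ENNReal.ofReal_le_ofReal (by
          have := Real.add_one_le_exp (-(2 / (3 * E))); linarith)
    have hb2 : b ^ N ≤ ENNReal.ofReal (1 / 4) := by
      calc b ^ N ≤ ENNReal.ofReal (Real.exp (-(2 / (3 * E)))) ^ N := by gcongr
        _ = ENNReal.ofReal (Real.exp (-(2 / (3 * E))) ^ N) :=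
          (ENNReal.ofReal_pow (Real.exp_pos _).le _).symm
        _ ≤ _ := ENNReal.ofReal_le_ofReal ?_
      rw [← Real.exp_nat_mul]
      have hNE : 3 * E ≤ N := Nat.le_ceil _
      -- All `N` draws fail with probability at most `exp (-2) ≤ 1 / 4`; this is what `N ≥ 3 * E` is
      -- for.
      have h2 : (N : ℝ) * -(2 / (3 * E)) ≤ -2 := by
        have : (2 : ℝ) ≤ N * (2 / (3 * E)) := by
          rw [mul_div_assoc', le_div_iff₀ (by positivity)]
          linarith
        linarith
      calc Real.exp (N * -(2 / (3 * E))) ≤ Real.exp (-2) := Real.exp_le_exp.2 h2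
        _ ≤ 1 / 4 := by
          rw [Real.exp_neg, inv_le_comm₀ (Real.exp_pos _) (by norm_num)]
          have h1 := Real.add_one_le_exp (1 : ℝ)
          have : Real.exp 2 = Real.exp 1 * Real.exp 1 := by rw [← Real.exp_add]; norm_num
          rw [this]
          nlinarith
    have hsum := toOuterMeasure_add_compl P
      {H | ∃ h ∈ H, D.toOuterMeasure {x | c x ≠ h x} ≤ ENNReal.ofReal (1 / 4)}
    have h34 : ENNReal.ofReal (1 - 1 / 4) + ENNReal.ofReal (1 / 4) = 1 := by
      rw [← ENNReal.ofReal_add (by norm_num) (by norm_num)]; norm_num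
    have hle : (1 : ℝ≥0∞) ≤ P.toOuterMeasure
        {H | ∃ h ∈ H, D.toOuterMeasure {x | c x ≠ h x} ≤ ENNReal.ofReal (1 / 4)} +
          ENNReal.ofReal (1 / 4) := by
      rw [← hsum]
      exact add_le_add_right (hbad.trans hb2) _
    rw [← h34] at hle
    exact (ENNReal.add_le_add_iff_right ENNReal.ofReal_ne_top).1 hle
  · refine iSup₂_le fun H hH => ENNReal.ofReal_le_ofReal ?_
    rw [hP, PMF.mem_support_map_iff] at hH
    obtain ⟨t, _, rfl⟩ := hH
    have hcard : ((Finset.univ.image t).card : ℝ) ≤ N := by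
      have := Finset.card_image_le (s := Finset.univ) (f := t)
      rw [Finset.card_univ, Fintype.card_fin] at this
      exact_mod_cast this
    -- `N ≤ 3 * E + 1 ≤ E ^ 3` needs `E ≥ 2`, which is where the existence of two concepts enters.
    have hNle : (N : ℝ) ≤ E ^ 3 := by
      have := (Nat.ceil_lt_add_one (a := 3 * E) (by linarith)).le
      rw [← hN] at this
      nlinarith [mul_nonneg (by linarith : (0:ℝ) ≤ E - 2) (by positivity : (0:ℝ) ≤ E * E),
        mul_nonneg (by linarith : (0:ℝ) ≤ E - 2) (by linarith : (0:ℝ) ≤ E)]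
    have h3 : Real.log (E ^ 3) = 3 * (ε * n) := by
      rw [Real.log_pow, hE, Real.log_exp]; norm_num
    rw [← h3]
    rcases Nat.eq_zero_or_pos (Finset.univ.image t).card with h0 | h0
    · rw [h0]
      simp only [Nat.cast_zero, Real.log_zero]
      exact Real.log_nonneg (by nlinarith [pow_le_pow_left₀ (by norm_num) hE2 3])
    · exact Real.log_le_log (by exact_mod_cast h0) (hcard.trans hNle)

end Representation

/-! ### Chi-square comparison of distributions -/

section ChiSquare

variable {Ω : Type*} {p q : PMF Ω} {κ : ℝ}

theorem mean_iid_prod (n : ℕ) (p : PMF Ω) {f : Ω → ℝ} (hf : IsBdd f) (h0 : ∀ x, 0 ≤ f x) :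
    (mean (iid n p) fun x => ∏ i, f (x i)) = mean p f ^ n := by
  have hb : IsBdd fun x : Fin n → Ω => ∏ i, f (x i) := by
    obtain ⟨M, hM⟩ := hf
    refine ⟨∏ _i : Fin n, M, fun x => ?_⟩
    rw [Finset.abs_prod]
    exact Finset.prod_le_prod (fun _ _ => abs_nonneg _) fun i _ => hM _
  have h := expect_iid_prod n p fun _ x => ENNReal.ofReal (f x)
  simp only [← ENNReal.ofReal_prod_of_nonneg fun _ _ => h0 _] at h
  rw [expect_ofReal _ hb fun x => Finset.prod_nonneg fun _ _ => h0 _, Finset.prod_const,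
    expect_ofReal p hf h0, ← ENNReal.ofReal_pow (mean_nonneg p h0),
    ENNReal.ofReal_eq_ofReal_iff
      (mean_nonneg _ fun x => Finset.prod_nonneg fun _ _ => h0 _) (by
        exact pow_nonneg (mean_nonneg p h0) _)] at h
  simpa using h

/-- `p` has a bounded density with respect to `q`, and their chi-square divergence is at
most `κ`. -/
def ChiSqLE (p q : PMF Ω) (κ : ℝ) : Prop :=
  ∃ L : Ω → ℝ, IsBdd L ∧ (∀ w, 0 ≤ L w) ∧ (∀ w, p w = q w * ENNReal.ofReal (L w)) ∧
    mean q (fun w => L w ^ 2) ≤ 1 + κ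

theorem ChiSqLE.mono (h : ChiSqLE p q κ) {κ' : ℝ} (hκ : κ ≤ κ') : ChiSqLE p q κ' := by
  obtain ⟨L, h1, h2, h3, h4⟩ := h
  exact ⟨L, h1, h2, h3, h4.trans (by linarith)⟩

/-- The density of a product is the product of the densities, so second moments multiply. -/
theorem ChiSqLE.iid (h : ChiSqLE p q κ) (n : ℕ) :
    ChiSqLE (iid n p) (iid n q) ((1 + κ) ^ n - 1) := by
  obtain ⟨L, h1, h2, h3, h4⟩ := h
  refine ⟨fun x => ∏ i, L (x i), ?_, fun x => Finset.prod_nonneg fun _ _ => h2 _, fun x => ?_, ?_⟩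
  · obtain ⟨M, hM⟩ := h1
    refine ⟨∏ _i : Fin n, M, fun x => ?_⟩
    rw [Finset.abs_prod]
    exact Finset.prod_le_prod (fun _ _ => abs_nonneg _) fun i _ => hM _
  · change ∏ i, p (x i) = (∏ i, q (x i)) * _
    rw [ENNReal.ofReal_prod_of_nonneg fun _ _ => h2 _, ← Finset.prod_mul_distrib]
    exact Finset.prod_congr rfl fun i _ => h3 _
  · simp_rw [← Finset.prod_pow]
    rw [mean_iid_prod n q (h1.pow 2) fun x => sq_nonneg _]
    have := pow_le_pow_left₀ (mean_nonneg q fun w => sq_nonneg (L w)) h4 n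
    linarith

/-- The difference of the means is the `q`-mean of `(L - 1) * (F - a)`; this is Cauchy–Schwarz,
carried out as a weighted AM–GM under the mean. -/
theorem ChiSqLE.mean_le (h : ChiSqLE p q κ) (hκ : 0 < κ) {F : Ω → ℝ} {a b : ℝ}
    (hF : ∀ w, a ≤ F w ∧ F w ≤ b) : mean p F ≤ mean q F + √κ * (b - a) := by
  obtain ⟨L, hL, h0, hpq, h2⟩ := h
  have hFb : IsBdd F := isBdd_of_mem_Icc hF
  have hden : ∀ G : Ω → ℝ, mean p G = mean q fun w => L w * G w := fun G => by
    refine tsum_congr fun w => ?_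
    rw [hpq, ENNReal.toReal_mul, ENNReal.toReal_ofReal (h0 w), mul_assoc]
  have hL1 : mean q L = 1 := by
    have := hden fun _ => 1
    rw [mean_const] at this
    simpa using this.symm
  obtain ⟨w₀, hw₀⟩ := p.support_nonempty
  rcases (((hF w₀).1.trans (hF w₀).2).eq_or_lt : a = b ∨ a < b) with hab | hab
  · have hc : F = fun _ => a := funext fun w => le_antisymm (hab ▸ (hF w).2) (hF w).1
    rw [hc, mean_const, mean_const, hab]
    simp
  · set r := √κ with hr
    have hr0 : 0 < r := Real.sqrt_pos.2 hκ
    have hrκ : r * r = κ := Real.mul_self_sqrt hκ.le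
    set Δ := b - a with hΔ
    have hΔ0 : 0 < Δ := sub_pos.2 hab
    have hLm : IsBdd fun w => L w - 1 := hL.sub (isBdd_const 1)
    have hFm : IsBdd fun w => F w - a := hFb.sub (isBdd_const a)
    have e1 : mean p F - mean q F = mean q fun w => (L w - 1) * (F w - a) := by
      have : (fun w => (L w - 1) * (F w - a)) = fun w => (L w * F w - F w) - (a * L w - a) := by
        funext w; ring
      rw [this, mean_sub q ((hL.mul hFb).sub hFb) (((isBdd_const a).mul hL).sub (isBdd_const a)),
        mean_sub q (hL.mul hFb) hFb, mean_sub q ((isBdd_const a).mul hL) (isBdd_const a),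
        mean_const_mul, hL1, mean_const, ← hden]
      ring
    have e2 : (mean q fun w => (L w - 1) ^ 2) ≤ κ := by
      have : (fun w => (L w - 1) ^ 2) = fun w => (L w ^ 2 - 2 * L w) + 1 := by
        funext w; ring
      rw [this, mean_add q ((hL.pow 2).sub ((isBdd_const 2).mul hL)) (isBdd_const 1),
        mean_sub q (hL.pow 2) ((isBdd_const 2).mul hL), mean_const_mul, hL1, mean_const]
      linarith
    -- The weight is chosen so that both terms contribute at most `r * Δ / 2`.
    have e3 : (mean q fun w => (L w - 1) * (F w - a)) ≤
        mean q fun w => Δ / (2 * r) * (L w - 1) ^ 2 + r * Δ / 2 := by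
      refine mean_mono q (hLm.mul hFm) (((isBdd_const _).mul (hLm.pow 2)).add (isBdd_const _))
        fun w => ?_
      have hx0 : 0 ≤ F w - a := sub_nonneg.2 (hF w).1
      have hx1 : F w - a ≤ Δ := by rw [hΔ]; linarith [(hF w).2]
      have hsq : (F w - a) ^ 2 ≤ Δ ^ 2 := pow_le_pow_left₀ hx0 hx1 2
      have key : Δ / (2 * r) * (L w - 1) ^ 2 + r * Δ / 2 - (L w - 1) * (F w - a) =
          ((Δ * (L w - 1) - r * (F w - a)) ^ 2 + r ^ 2 * (Δ ^ 2 - (F w - a) ^ 2)) /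
            (2 * r * Δ) := by
        field_simp
        ring
      have : 0 ≤ ((Δ * (L w - 1) - r * (F w - a)) ^ 2 + r ^ 2 * (Δ ^ 2 - (F w - a) ^ 2)) /
            (2 * r * Δ) :=
        div_nonneg (add_nonneg (sq_nonneg _) (mul_nonneg (sq_nonneg _) (sub_nonneg.2 hsq)))
          (by positivity)
      linarith
    rw [mean_add q ((isBdd_const _).mul (hLm.pow 2)) (isBdd_const _), mean_const_mul,
      mean_const] at e3
    have e4 : Δ / (2 * r) * (mean q fun w => (L w - 1) ^ 2) ≤ Δ / (2 * r) * κ :=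
      mul_le_mul_of_nonneg_left e2 (by positivity)
    have e5 : Δ / (2 * r) * κ = r * Δ / 2 := by
      rw [← hrκ]
      field_simp
    linarith

theorem one_add_pow_sub_one_le {t : ℝ} (ht : 0 ≤ t) (n : ℕ) (h : n * t ≤ 1) :
    (1 + t) ^ n - 1 ≤ 2 * (n * t) := by
  have h1 : (1 + t) ^ n ≤ Real.exp (n * t) := by
    rw [Real.exp_nat_mul]
    exact pow_le_pow_left₀ (by linarith) (by linarith [Real.add_one_le_exp t]) n
  have hnt : 0 ≤ n * t := by positivity
  have h2 := Real.abs_exp_sub_one_le (x := n * t) (by rwa [abs_of_nonneg hnt])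
  rw [abs_of_nonneg hnt] at h2
  linarith [le_abs_self (Real.exp (n * t) - 1)]

/-- For functions of one user's data that vary by a factor at most `exp ε`, replacing the
distribution of the data by one at small chi-square divergence changes little. -/
theorem ChiSqLE.expect_le_exp {m : ℕ} {γ ε : ℝ} (hm : 1 ≤ m) (hγ : 0 < γ) (hε : 0 < ε)
    (hε1 : ε ≤ 1) (h : ChiSqLE p q ((1 + γ ^ 2) ^ m - 1)) {F : Ω → ℝ≥0∞}
    (hF : ∀ w w', F w ≤ ENNReal.ofReal (Real.exp ε) * F w') :
    expect p F ≤ ENNReal.ofReal (Real.exp (4 * ε * γ * √m)) * expect q F := by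
  -- The chi-square bound is useful only in this range. Otherwise `γ * √m ≥ 1` and the trivial
  -- factor `exp ε` is enough.
  by_cases hm1 : m * γ ^ 2 ≤ 1
  · by_cases htop : ∃ w, F w = ⊤
    · obtain ⟨w₀, hw₀⟩ := htop
      have hall : F = fun _ => ⊤ := funext fun w => by
        by_contra hne
        have h1 := hF w₀ w
        rw [hw₀, top_le_iff] at h1
        exact ENNReal.mul_ne_top ENNReal.ofReal_ne_top hne h1
      rw [hall, expect_const, expect_const, ENNReal.mul_top]
      rw [Ne, ENNReal.ofReal_eq_zero, not_le]
      exact Real.exp_pos _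
    · push Not at htop
      set f : Ω → ℝ := fun w => (F w).toReal with hf
      have hFf : F = fun w => ENNReal.ofReal (f w) :=
        funext fun w => (ENNReal.ofReal_toReal (htop w)).symm
      have hf0 : ∀ w, 0 ≤ f w := fun w => ENNReal.toReal_nonneg
      have hff : ∀ w w', f w ≤ Real.exp ε * f w' := fun w w' => by
        have := ENNReal.toReal_mono (ENNReal.mul_ne_top ENNReal.ofReal_ne_top (htop w')) (hF w w')
        rwa [ENNReal.toReal_mul, ENNReal.toReal_ofReal (Real.exp_pos _).le] at this
      obtain ⟨w₀, _⟩ := p.support_nonempty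
      have : Nonempty Ω := ⟨w₀⟩
      -- All values lie in `[a, exp ε * a]`, an interval of width at most `2 * ε * mean q f`; this
      -- turns the additive chi-square error into a multiplicative one.
      set a := ⨅ w, f w with ha
      have hbdd : BddBelow (Set.range f) := ⟨0, by rintro _ ⟨w, rfl⟩; exact hf0 w⟩
      have haf : ∀ w, a ≤ f w := fun w => ciInf_le hbdd w
      have ha0 : 0 ≤ a := le_ciInf hf0
      have hfa : ∀ w, f w ≤ Real.exp ε * a := fun w => by
        rw [← div_le_iff₀' (Real.exp_pos _)]
        exact le_ciInf fun w' => (div_le_iff₀' (Real.exp_pos _)).2 (hff w w')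
      have hb : IsBdd f := isBdd_of_mem_Icc fun w => ⟨haf w, hfa w⟩
      have hm0 : (0 : ℝ) < m := by exact_mod_cast hm
      have hκ : (1 + γ ^ 2) ^ m - 1 ≤ 2 * (m * γ ^ 2) :=
        one_add_pow_sub_one_le (sq_nonneg γ) m hm1
      have hmean := (h.mono hκ).mean_le (by positivity) fun w => ⟨haf w, hfa w⟩
      have hsq : √(2 * (m * γ ^ 2)) ≤ 2 * (γ * √m) := by
        rw [Real.sqrt_le_left (by positivity), mul_pow, mul_pow, Real.sq_sqrt hm0.le]
        nlinarith [mul_pos hm0 (pow_pos hγ 2)]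
      have hexp : Real.exp ε - 1 ≤ 2 * ε := by
        have := Real.abs_exp_sub_one_le (x := ε) (by rwa [abs_of_pos hε])
        rw [abs_of_pos hε] at this
        linarith [le_abs_self (Real.exp ε - 1)]
      have hexp0 : 0 ≤ Real.exp ε - 1 := by linarith [Real.add_one_le_exp ε]
      have hamean : a ≤ mean q f := by
        have := mean_mono q (isBdd_const a) hb haf
        rwa [mean_const] at this
      have hfin : mean p f ≤ Real.exp (4 * ε * γ * √m) * mean q f := by
        have s1 : √(2 * (m * γ ^ 2)) * (Real.exp ε * a - a) ≤
            2 * (γ * √m) * (2 * ε * mean q f) := by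
          have : Real.exp ε * a - a = (Real.exp ε - 1) * a := by ring
          rw [this]
          exact mul_le_mul hsq (mul_le_mul hexp hamean ha0 (by positivity))
            (mul_nonneg hexp0 ha0) (by positivity)
        have s2 := Real.add_one_le_exp (4 * ε * γ * √m)
        nlinarith [mean_nonneg q hf0]
      rw [hFf, expect_ofReal p hb hf0, expect_ofReal q hb hf0,
        ← ENNReal.ofReal_mul (Real.exp_pos _).le]
      exact ENNReal.ofReal_le_ofReal hfin
  · push Not at hm1
    have h1 : expect p F ≤ ENNReal.ofReal (Real.exp ε) * expect q F := by
      rw [← expect_const_mul, ← expect_const q (expect p F)]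
      refine expect_mono fun w' => ?_
      calc expect p F ≤ expect p fun _ => ENNReal.ofReal (Real.exp ε) * F w' :=
            expect_mono fun w => hF w w'
        _ = _ := expect_const _ _
    refine h1.trans (mul_le_mul_left (ENNReal.ofReal_le_ofReal (Real.exp_le_exp.2 ?_)) _)
    have h2 : 1 ≤ γ * √m := by
      rw [← Real.sqrt_sq hγ.le, ← Real.sqrt_mul (sq_nonneg γ), Real.one_le_sqrt]
      linarith
    nlinarith

end ChiSquare

/-! ### Noisy labels on a finite set -/

section Noisy

variable {X : Type*}

/-- The sign of a label. -/
def sgn (y : Bool) : ℝ := if y then 1 else -1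

@[simp] theorem sgn_true : sgn true = 1 := rfl

@[simp] theorem sgn_false : sgn false = -1 := by simp [sgn]

theorem abs_sgn (y : Bool) : |sgn y| = 1 := by cases y <;> simp

open Classical in
/-- A uniformly random point of `S` with a random label of bias `b`. -/
def noisy (S : Finset X) (hS : S.Nonempty) (b : X → ℝ) (hb : ∀ x, |b x| ≤ 1) : PMF (X × Bool) :=
  PMF.ofFinset
    (fun z => if z.1 ∈ S then ENNReal.ofReal ((1 + sgn z.2 * b z.1) / (2 * S.card)) else 0)
    (S ×ˢ Finset.univ)
    (by
      have hc : (0 : ℝ) < S.card := by exact_mod_cast hS.card_pos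
      rw [Finset.sum_product, ← ENNReal.ofReal_one]
      have h : ∀ x ∈ S, ∑ y : Bool, (if x ∈ S then
          ENNReal.ofReal ((1 + sgn y * b x) / (2 * S.card)) else 0) =
          ENNReal.ofReal (1 / S.card) := by
        intro x hx
        have hx1 := abs_le.1 (hb x)
        simp only [hx, if_true, Fintype.sum_bool, sgn_true, sgn_false]
        rw [← ENNReal.ofReal_add (div_nonneg (by linarith) (by positivity))
          (div_nonneg (by linarith) (by positivity))]
        congr 1
        field_simp
        ring
      rw [Finset.sum_congr rfl h, Finset.sum_const, nsmul_eq_mul, ← ENNReal.ofReal_natCast,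
        ← ENNReal.ofReal_mul (by positivity)]
      congr 1
      field_simp)
    (by
      intro z hz
      rw [if_neg]
      intro h
      exact hz (Finset.mem_product.2 ⟨h, Finset.mem_univ _⟩))

variable {S : Finset X} {hS : S.Nonempty}

open Classical in
theorem noisy_apply {b : X → ℝ} (hb : ∀ x, |b x| ≤ 1) (z : X × Bool) :
    noisy S hS b hb z =
      if z.1 ∈ S then ENNReal.ofReal ((1 + sgn z.2 * b z.1) / (2 * S.card)) else 0 := rfl

theorem mean_noisy {b : X → ℝ} (hb : ∀ x, |b x| ≤ 1) (f : X × Bool → ℝ) :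
    mean (noisy S hS b hb) f =
      ∑ x ∈ S, ((1 + b x) * f (x, true) + (1 - b x) * f (x, false)) / (2 * S.card) := by
  classical
  rw [mean, tsum_eq_sum (s := S ×ˢ Finset.univ), Finset.sum_product]
  · refine Finset.sum_congr rfl fun x hx => ?_
    have hx1 := abs_le.1 (hb x)
    simp only [Fintype.sum_bool, noisy_apply, hx, if_true, sgn_true, sgn_false]
    rw [ENNReal.toReal_ofReal (div_nonneg (by linarith) (by positivity)),
      ENNReal.toReal_ofReal (div_nonneg (by linarith) (by positivity))]
    ring
  · intro z hz
    rw [noisy_apply, if_neg]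
    · simp
    · intro h
      exact hz (Finset.mem_product.2 ⟨h, Finset.mem_univ _⟩)

/-- Since the bias changes only where it was zero, the density is exactly `1 + sgn y * e x`: the
cross term `b * e` vanishes. -/
theorem chiSqLE_noisy {b b' e : X → ℝ} (hb : ∀ x, |b x| ≤ 1) (hb' : ∀ x, |b' x| ≤ 1)
    (hadd : ∀ x, b' x = b x + e x) (hmul : ∀ x, b x * e x = 0) (he : ∀ x, |e x| ≤ 1) :
    ChiSqLE (noisy S hS b' hb') (noisy S hS b hb) ((∑ x ∈ S, e x ^ 2) / S.card) := by
  classical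
  have hc : (0 : ℝ) < S.card := by exact_mod_cast hS.card_pos
  have hse : ∀ z : X × Bool, |sgn z.2 * e z.1| ≤ 1 := fun z => by
    rw [abs_mul, abs_sgn, one_mul]; exact he _
  refine ⟨fun z => 1 + sgn z.2 * e z.1, (isBdd_const 1).add ⟨1, hse⟩, fun z => ?_, fun z => ?_, ?_⟩
  · have := (abs_le.1 (hse z)).1
    linarith
  · rw [noisy_apply, noisy_apply]
    by_cases hz : z.1 ∈ S
    · rw [if_pos hz, if_pos hz, ← ENNReal.ofReal_mul]
      · congr 1
        rw [hadd]
        have h2 := hmul z.1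
        have h3 : sgn z.2 * sgn z.2 = 1 := by cases z.2 <;> simp
        rw [div_mul_eq_mul_div]
        congr 1
        linear_combination (- (sgn z.2 * sgn z.2)) * h2
      · have : |sgn z.2 * b z.1| ≤ 1 := by
          rw [abs_mul, abs_sgn, one_mul]; exact hb _
        have := (abs_le.1 this).1
        exact div_nonneg (by linarith) (by positivity)
    · rw [if_neg hz, if_neg hz, zero_mul]
  · rw [mean_noisy]
    have : ∀ x ∈ S, ((1 + b x) * (1 + sgn true * e x) ^ 2 +
        (1 - b x) * (1 + sgn false * e x) ^ 2) / (2 * S.card) =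
        1 / S.card + e x ^ 2 / S.card := by
      intro x _
      have h2 := hmul x
      simp only [sgn_true, sgn_false]
      field_simp
      linear_combination 4 * h2
    rw [Finset.sum_congr rfl this, Finset.sum_add_distrib, Finset.sum_const, nsmul_eq_mul,
      ← Finset.sum_div]
    apply le_of_eq
    field_simp

/-- The number of disagreements of `h` and `u` on `S`. -/
def disagree (S : Finset X) (h u : X → Bool) : ℕ := (S.filter fun x => h x ≠ u x).card

theorem err_eq_ofReal_mean (D : PMF (X × Bool)) (h : X → Bool) :
    err D h = ENNReal.ofReal (mean D fun z => if h z.1 ≠ z.2 then 1 else 0) := by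
  rw [← expect_ofReal, err, toOuterMeasure_eq_expect]
  · congr 1
    funext z
    by_cases hz : h z.1 = z.2 <;> simp [hz]
  · exact isBdd_of_mem_Icc (a := 0) (b := 1) fun z => by split_ifs <;> norm_num
  · intro z
    split_ifs <;> norm_num

theorem abs_mul_sgn_le {γ : ℝ} (hγ : 0 ≤ γ) (hγ1 : γ ≤ 1) (u : X → Bool) (x : X) :
    |γ * sgn (u x)| ≤ 1 := by
  rw [abs_mul, abs_sgn, mul_one, abs_of_nonneg hγ]
  exact hγ1

theorem err_noisy {γ : ℝ} (u h : X → Bool) (hb : ∀ x, |γ * sgn (u x)| ≤ 1) :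
    err (noisy S hS (fun x => γ * sgn (u x)) hb) h =
      ENNReal.ofReal ((1 - γ) / 2 + γ * disagree S h u / S.card) := by
  have hc : (0 : ℝ) < S.card := by exact_mod_cast hS.card_pos
  rw [err_eq_ofReal_mean, mean_noisy]
  congr 1
  have : ∀ x ∈ S, ((1 + γ * sgn (u x)) * (if h x ≠ true then 1 else 0) +
      (1 - γ * sgn (u x)) * (if h x ≠ false then 1 else 0)) / (2 * (S.card : ℝ)) =
      (1 - γ) / (2 * S.card) + γ / S.card * (if h x ≠ u x then 1 else 0) := by
    intro x _
    cases hx : h x <;> cases hu : u x <;> simp <;> field_simp <;> ring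
  rw [Finset.sum_congr rfl this, Finset.sum_add_distrib, Finset.sum_const, ← Finset.mul_sum,
    Finset.sum_boole, nsmul_eq_mul, disagree]
  field_simp

/-- Each disagreement with `u` on `S` costs excess error `γ / |S|`. With `γ = 20 * α`, success means
agreeing with `u` on all but a twentieth of `S`. -/
theorem disagree_le_of_mem_agnostic {C : Set (X → Bool)} {γ α : ℝ} (hγ1 : γ ≤ 1)
    (hα : 0 ≤ α) {u h c : X → Bool} (hb : ∀ x, |γ * sgn (u x)| ≤ 1) (hc : c ∈ C)
    (hcu : ∀ x ∈ S, c x = u x)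
    (hh : h ∈ agnostic C α (noisy S hS (fun x => γ * sgn (u x)) hb)) :
    γ * disagree S h u ≤ α * S.card := by
  have hcard : (0 : ℝ) < S.card := by exact_mod_cast hS.card_pos
  have h1 : err (noisy S hS (fun x => γ * sgn (u x)) hb) h ≤
      err (noisy S hS (fun x => γ * sgn (u x)) hb) c + ENNReal.ofReal α :=
    le_trans hh (add_le_add_left (iInf₂_le c hc) _)
  have h0 : disagree S c u = 0 := by
    rw [disagree, Finset.card_eq_zero, Finset.filter_eq_empty_iff]
    intro x hx
    simp [hcu x hx]
  rw [err_noisy, err_noisy, h0, ← ENNReal.ofReal_add (by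
    simp only [Nat.cast_zero, mul_zero, zero_div]; linarith) hα,
    ENNReal.ofReal_le_ofReal_iff (by
      simp only [Nat.cast_zero, mul_zero, zero_div]; linarith)] at h1
  simp only [Nat.cast_zero, mul_zero, zero_div, add_zero] at h1
  have h2 : γ * disagree S h u / S.card ≤ α := by linarith
  rwa [div_le_iff₀ hcard] at h2

-- The generating function of the Hamming distance from `h` over all labellings of `S`; it counts
-- Hamming balls without entropy estimates.
open Classical in
theorem sum_powerset_pow_disagree (S : Finset X) (h : X → Bool) (β : ℝ) :
    ∑ U ∈ S.powerset, β ^ disagree S h (fun x => decide (x ∈ U)) = (1 + β) ^ S.card := by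
  have h1 : ∀ x, (if h x then 1 else β) + (if h x then β else 1) = 1 + β := fun x => by
    split_ifs <;> ring
  rw [← Finset.prod_const, ← Finset.prod_congr rfl fun x _ => h1 x, Finset.prod_add]
  refine Finset.sum_congr rfl fun U hU => ?_
  have hUS := Finset.mem_powerset.1 hU
  have h2 : β ^ disagree S h (fun x => decide (x ∈ U)) =
      ∏ x ∈ S, if h x ≠ decide (x ∈ U) then β else 1 := by
    rw [disagree, Finset.prod_ite, Finset.prod_const, Finset.prod_const_one, mul_one]
  rw [h2, ← Finset.prod_sdiff hUS, mul_comm]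
  congr 1
  · refine Finset.prod_congr rfl fun x hx => ?_
    cases h x <;> simp [hx]
  · refine Finset.prod_congr rfl fun x hx => ?_
    have := (Finset.mem_sdiff.1 hx).2
    cases h x <;> simp [this]

end Noisy

/-! ### The lower bounds by the VC dimension -/

section VC

variable {X : Type*} {C : Set (X → Bool)} {S : Finset X}

open Classical in
theorem exists_agree_of_shatters (hsh : Shatters C S) (U : Finset X) :
    ∃ c ∈ C, ∀ x ∈ S, c x = decide (x ∈ U) := hsh fun x => decide (x ∈ U)

open Classical in
/-- Packing lower bound for private learners. -/
theorem card_le_of_private {n m : ℕ} {A : Algorithm n m (X × Bool) (X → Bool)} {α ε : ℝ}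
    (hm : 1 ≤ m) (hα : 0 < α) (hα1 : α ≤ 1 / 40) (hε : 0 < ε) (hε1 : ε ≤ 1)
    (hA : IsUserLevelDP A ε 0) (hU : IsUseful A (agnostic C α) (2 / 3))
    (hS : S.Nonempty) (hsh : Shatters C S) :
    (S.card : ℝ) ≤ 1280 * (α * ε * √m) * n := by
  set γ := 20 * α with hγ
  have hγ0 : 0 < γ := by positivity
  have hγ1 : γ ≤ 1 := by linarith
  set d := S.card with hd
  have hd0 : 0 < d := hS.card_pos
  have hdR : (0 : ℝ) < d := by exact_mod_cast hd0
  set u : Finset X → X → Bool := fun U x => decide (x ∈ U) with hu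
  have hb : ∀ U x, |γ * sgn (u U x)| ≤ 1 := fun U => abs_mul_sgn_le hγ0.le hγ1 (u U)
  set D : Finset X → PMF (X × Bool) := fun U => noisy S hS (fun x => γ * sgn (u U x)) (hb U)
    with hD
  have hb0 : ∀ _x : X, |(0 : ℝ)| ≤ 1 := fun _ => by simp
  set D₀ : PMF (X × Bool) := noisy S hS (fun _ => 0) hb0 with hD₀
  set E := 4 * ε * γ * √m with hE
  set Q := (iid n (iid m D₀)).bind A with hQ
  have hchi : ∀ U, ChiSqLE (iid m (D U)) (iid m D₀) ((1 + γ ^ 2) ^ m - 1) := fun U => by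
    refine ChiSqLE.iid ?_ m
    refine (chiSqLE_noisy (e := fun x => γ * sgn (u U x)) hb0 (hb U) (fun x => by simp)
      (fun x => by simp) (hb U)).mono (le_of_eq ?_)
    have : ∀ x ∈ S, (γ * sgn (u U x)) ^ 2 = γ ^ 2 := fun x _ => by
      rw [mul_pow, ← sq_abs (sgn _), abs_sgn]; ring
    rw [Finset.sum_congr rfl this, Finset.sum_const, nsmul_eq_mul]
    field_simp
  -- `Q` does not depend on `U`: every labelling's good set has mass at least `(2 / 3) * exp (-n *
  -- E)` under one common distribution.
  have hgood : ∀ U, ENNReal.ofReal (2 / 3) ≤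
      ENNReal.ofReal (Real.exp E) ^ n * Q.toOuterMeasure (agnostic C α (D U)) := fun U => by
    refine (hU (D U)).trans ?_
    rw [hQ, toOuterMeasure_bind_eq_expect, toOuterMeasure_bind_eq_expect]
    exact expect_iid_le_pow (fun F hF => (hchi U).expect_le_exp hm hγ0 hε hε1 hF) n _
      fun x x' hx => hA.le_mul hx _
  -- A Chernoff weight: if `20 * disagree ≤ d` then `β ^ disagree ≥ (7 / 8) ^ d`.
  set β : ℝ := (7 / 8) ^ 20 with hβ
  have hcount : ∀ h : X → Bool,
      ∑ U ∈ S.powerset, (agnostic C α (D U)).indicator (1 : (X → Bool) → ℝ≥0∞) h ≤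
        ENNReal.ofReal (((1 + β) / (7 / 8)) ^ d) := fun h => by
    calc ∑ U ∈ S.powerset, (agnostic C α (D U)).indicator (1 : (X → Bool) → ℝ≥0∞) h
        ≤ ∑ U ∈ S.powerset, ENNReal.ofReal (β ^ disagree S h (u U) / (7 / 8) ^ d) := by
          refine Finset.sum_le_sum fun U _ => ?_
          by_cases hh : h ∈ agnostic C α (D U)
          · rw [Set.indicator_of_mem hh, Pi.one_apply, ENNReal.one_le_ofReal,
              one_le_div (by positivity), hβ, ← pow_mul]
            refine pow_le_pow_of_le_one (by norm_num) (by norm_num) ?_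
            obtain ⟨c, hc, hcu⟩ := exists_agree_of_shatters hsh U
            have := disagree_le_of_mem_agnostic hγ1 hα.le (hb U) hc hcu hh
            have h2 : 20 * (disagree S h (u U) : ℝ) ≤ d := by
              rw [hγ] at this
              have h3 : α * (20 * disagree S h (u U)) ≤ α * d := by linarith
              exact le_of_mul_le_mul_left h3 hα
            exact_mod_cast h2
          · rw [Set.indicator_of_notMem hh]
            exact zero_le
      _ = _ := by
          rw [← ENNReal.ofReal_sum_of_nonneg fun U _ => by positivity, ← Finset.sum_div,
            sum_powerset_pow_disagree, ← div_pow]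
  have hsum : ENNReal.ofReal (2 ^ d * (2 / 3)) ≤
      ENNReal.ofReal (Real.exp E) ^ n * ENNReal.ofReal (((1 + β) / (7 / 8)) ^ d) := by
    calc ENNReal.ofReal (2 ^ d * (2 / 3)) = ∑ _U ∈ S.powerset, ENNReal.ofReal (2 / 3) := by
          rw [Finset.sum_const, Finset.card_powerset, nsmul_eq_mul,
            ENNReal.ofReal_mul (by positivity), ENNReal.ofReal_pow (by norm_num)]
          simp [hd]
      _ ≤ ∑ U ∈ S.powerset, ENNReal.ofReal (Real.exp E) ^ n *
            Q.toOuterMeasure (agnostic C α (D U)) := Finset.sum_le_sum fun U _ => hgood U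
      _ = ENNReal.ofReal (Real.exp E) ^ n * expect Q fun h =>
            ∑ U ∈ S.powerset, (agnostic C α (D U)).indicator (1 : (X → Bool) → ℝ≥0∞) h := by
          rw [← Finset.mul_sum, expect_sum]
          simp only [toOuterMeasure_eq_expect]
      _ ≤ _ := by
          refine mul_le_mul_right ?_ _
          rw [← expect_const Q (ENNReal.ofReal _)]
          exact expect_mono hcount
  rw [← ENNReal.ofReal_pow (Real.exp_pos _).le, ← ENNReal.ofReal_mul (by positivity),
    ENNReal.ofReal_le_ofReal_iff (by positivity), ← Real.exp_nat_mul] at hsum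
  have hR0 : 0 < (1 + β) / (7 / 8) := by positivity
  -- A hypothesis is thus good for at most a fraction `(5 / 8) ^ d` of the `2 ^ d` labellings.
  have hR : (1 + β) / (7 / 8) * (8 / 5) ≤ 2 := by
    rw [hβ]; norm_num
  -- One factor `8 / 5` absorbs the success probability, as `(8 / 5) * (2 / 3) = 16 / 15`; hence `d
  -- ≥ 1` is needed.
  have h1 : (16 / 15 : ℝ) ^ d ≤ Real.exp (n * E) := by
    have h2 : (((1 + β) / (7 / 8)) ^ d * (8 / 5) ^ d : ℝ) ≤ 2 ^ d := by
      rw [← mul_pow]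
      exact pow_le_pow_left₀ (by positivity) hR d
    have h3 : (8 / 5 : ℝ) ^ d * (2 / 3) ≤ Real.exp (n * E) := by
      have h4 : ((1 + β) / (7 / 8)) ^ d * ((8 / 5 : ℝ) ^ d * (2 / 3)) ≤
          ((1 + β) / (7 / 8)) ^ d * Real.exp (n * E) := by nlinarith
      exact le_of_mul_le_mul_left h4 (by positivity)
    refine le_trans ?_ h3
    obtain ⟨k, hk⟩ := Nat.exists_eq_succ_of_ne_zero hd0.ne'
    rw [hk, pow_succ, pow_succ]
    have : (16 / 15 : ℝ) ^ k ≤ (8 / 5) ^ k := pow_le_pow_left₀ (by norm_num) (by norm_num) k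
    linarith
  have h5 : (d : ℝ) * (1 / 16) ≤ n * E := by
    have h6 : Real.log ((16 / 15 : ℝ) ^ d) ≤ n * E := by
      rw [Real.log_le_iff_le_exp (by positivity)]
      exact h1
    rw [Real.log_pow] at h6
    have h7 := Real.one_sub_inv_le_log_of_pos (x := 16 / 15) (by norm_num)
    have h8 : (1 / 16 : ℝ) ≤ Real.log (16 / 15) := by
      refine le_trans (by norm_num) h7
    nlinarith
  rw [hE, hγ] at h5
  linarith

theorem mean_bind_toReal {n m : ℕ} {Z O : Type*} (A : Algorithm n m Z O)
    (p : PMF (Fin n → Fin m → Z)) (G : Set O) :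
    mean p (fun x => ((A x).toOuterMeasure G).toReal) = ((p.bind A).toOuterMeasure G).toReal := by
  have hb : ∀ x, ((A x).toOuterMeasure G).toReal ≤ 1 := fun x => by
    have := ENNReal.toReal_mono ENNReal.one_ne_top (toOuterMeasure_le_one (A x) G)
    simpa using this
  rw [toOuterMeasure_bind_eq_expect]
  have h : (expect p fun x => (A x).toOuterMeasure G) =
      expect p fun x => ENNReal.ofReal (((A x).toOuterMeasure G).toReal) := by
    congr 1
    funext x
    rw [ENNReal.ofReal_toReal]
    exact ((toOuterMeasure_le_one _ _).trans_lt ENNReal.one_lt_top).ne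
  rw [h, expect_ofReal, ENNReal.toReal_ofReal]
  · exact mean_nonneg p fun x => ENNReal.toReal_nonneg
  · exact isBdd_of_mem_Icc fun x => ⟨ENNReal.toReal_nonneg, hb x⟩
  · exact fun x => ENNReal.toReal_nonneg

theorem isBdd_indicator {Ω : Type*} (G : Set Ω) : IsBdd (G.indicator (1 : Ω → ℝ)) :=
  isBdd_of_mem_Icc (a := 0) (b := 1) fun x => by by_cases hx : x ∈ G <;> simp [hx]

theorem toReal_toOuterMeasure {Ω : Type*} (p : PMF Ω) (G : Set Ω) :
    (p.toOuterMeasure G).toReal = mean p (G.indicator 1) := by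
  have h0 : ∀ x, (0 : ℝ) ≤ G.indicator (1 : Ω → ℝ) x := fun x =>
    Set.indicator_nonneg (fun _ _ => zero_le_one) x
  rw [← ENNReal.toReal_ofReal (mean_nonneg p h0), ← expect_ofReal _ _ h0, toOuterMeasure_eq_expect]
  · congr 2
    funext x
    by_cases hx : x ∈ G <;> simp [hx]
  · exact isBdd_indicator G

open Classical in
/-- The sample complexity lower bound for agnostic learners, by Assouad's method. -/
theorem card_le_of_useful {n m : ℕ} {A : Algorithm n m (X × Bool) (X → Bool)} {α : ℝ}
    (hα : 0 < α) (hα1 : α ≤ 1 / 40) (hU : IsUseful A (agnostic C α) (2 / 3))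
    (hS : S.Nonempty) (hsh : Shatters C S) :
    (S.card : ℝ) ≤ 80000 * (α ^ 2 * m) * n := by
  by_contra hcon
  push Not at hcon
  set γ := 20 * α with hγ
  have hγ0 : 0 < γ := by positivity
  have hγ1 : γ ≤ 1 := by linarith
  set d := S.card with hd
  have hd0 : 0 < d := hS.card_pos
  have hdR : (0 : ℝ) < d := by exact_mod_cast hd0
  set u : Finset X → X → Bool := fun U x => decide (x ∈ U) with hu
  have hb : ∀ U x, |γ * sgn (u U x)| ≤ 1 := fun U => abs_mul_sgn_le hγ0.le hγ1 (u U)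
  set D : Finset X → PMF (X × Bool) := fun U => noisy S hS (fun x => γ * sgn (u U x)) (hb U)
    with hD
  set R : PMF (X × Bool) → PMF (X → Bool) := fun D => (iid n (iid m D)).bind A with hR
  set e : Finset X → X → ℝ := fun U x => ((R (D U)).toOuterMeasure {h | h x ≠ u U x}).toReal
    with he
  -- A successful output errs on at most `d / 20` points, a failed one on at most `d`, and failure
  -- has probability at most 1/3; `1 / 20 + 1 / 3 = 23 / 60`.
  have hupper : ∀ U, ∑ x ∈ S, e U x ≤ 23 / 60 * d := fun U => by
    have h1 : ∑ x ∈ S, e U x =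
        mean (R (D U)) fun h => ∑ x ∈ S, {h : X → Bool | h x ≠ u U x}.indicator 1 h := by
      rw [mean_sum _ _ fun x _ => isBdd_indicator _]
      exact Finset.sum_congr rfl fun x _ => toReal_toOuterMeasure _ _
    have h2 : (mean (R (D U)) fun h => ∑ x ∈ S,
        {h : X → Bool | h x ≠ u U x}.indicator (1 : (X → Bool) → ℝ) h) ≤
        mean (R (D U)) fun h => d / 20 + d * (agnostic C α (D U))ᶜ.indicator 1 h := by
      refine mean_mono _ (IsBdd.sum _ fun x _ => isBdd_indicator _)
        ((isBdd_const _).add ((isBdd_const _).mul (isBdd_indicator _))) fun h => ?_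
      have hdis : (∑ x ∈ S, {h : X → Bool | h x ≠ u U x}.indicator (1 : (X → Bool) → ℝ) h) =
          disagree S h (u U) := by
        rw [disagree, ← Finset.sum_boole]
        refine Finset.sum_congr rfl fun x _ => ?_
        by_cases hx : h x = u U x <;> simp [hx]
      rw [hdis]
      by_cases hh : h ∈ agnostic C α (D U)
      · obtain ⟨c, hc, hcu⟩ := exists_agree_of_shatters hsh U
        have := disagree_le_of_mem_agnostic hγ1 hα.le (hb U) hc hcu hh
        rw [hγ] at this
        have h3 : α * (20 * disagree S h (u U)) ≤ α * d := by linarith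
        have h4 := le_of_mul_le_mul_left h3 hα
        rw [Set.indicator_of_notMem (by simpa using hh)]
        linarith
      · have : (disagree S h (u U) : ℝ) ≤ d := by
          exact_mod_cast Finset.card_filter_le _ _
        rw [Set.indicator_of_mem (by simpa using hh), Pi.one_apply]
        linarith
    rw [mean_add _ (isBdd_const _) ((isBdd_const _).mul (isBdd_indicator _)), mean_const,
      mean_const_mul, ← toReal_toOuterMeasure] at h2
    have h3 : ((R (D U)).toOuterMeasure (agnostic C α (D U))ᶜ).toReal ≤ 1 / 3 := by
      refine ENNReal.toReal_le_of_le_ofReal (by norm_num) ?_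
      rw [toOuterMeasure_compl, tsub_le_iff_right]
      refine le_trans ?_ (add_le_add_right (hU (D U)) _)
      rw [← ENNReal.ofReal_add (by norm_num) (by norm_num)]
      norm_num
    rw [h1]
    nlinarith
  -- The two problems differ only in the bias at `x`. Against the problem with that bias erased,
  -- each changes the probability of predicting `true` at `x` by at most 1/10, so the two errors sum
  -- to at least `1 - 2 / 10`.
  have hlower : ∀ x ∈ S, ∀ U ∈ (S.erase x).powerset, 4 / 5 ≤ e U x + e (insert x U) x := by
    intro x hxS U hUmem
    have hxU : x ∉ U := fun h => by
      have := Finset.mem_powerset.1 hUmem h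
      simp at this
    set b₀ : X → ℝ := Function.update (fun y => γ * sgn (u U y)) x 0 with hb₀
    have hb₀1 : ∀ y, |b₀ y| ≤ 1 := fun y => by
      by_cases hy : y = x
      · subst hy; simp [hb₀]
      · rw [hb₀, Function.update_of_ne hy]; exact hb U y
    set D₀ := noisy S hS b₀ hb₀1 with hD₀
    have hchi : ∀ V : Finset X, (∀ y, y ≠ x → u V y = u U y) →
        ChiSqLE (iid n (iid m (D V))) (iid n (iid m D₀)) (1 / 100) := by
      intro V hV
      set ev : X → ℝ := Function.update (fun _ => 0) x (γ * sgn (u V x)) with hev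
      have hbase : ChiSqLE (D V) D₀ (γ ^ 2 / d) := by
        refine (chiSqLE_noisy (e := ev) hb₀1 (hb V) (fun y => ?_) (fun y => ?_)
          (fun y => ?_)).mono (le_of_eq ?_)
        · by_cases hy : y = x
          · subst hy; simp [hb₀, hev]
          · rw [hb₀, hev, Function.update_of_ne hy, Function.update_of_ne hy, hV y hy, add_zero]
        · by_cases hy : y = x
          · subst hy; simp [hb₀]
          · rw [hev, Function.update_of_ne hy, mul_zero]
        · by_cases hy : y = x
          · subst hy
            rw [hev, Function.update_self]
            exact hb V y
          · rw [hev, Function.update_of_ne hy]; simp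
        · rw [Finset.sum_eq_single x]
          · rw [hev, Function.update_self, mul_pow, ← sq_abs (sgn _), abs_sgn]
            ring
          · intro y _ hy
            rw [hev, Function.update_of_ne hy]; ring
          · exact fun h => absurd hxS h
      refine ((hbase.iid m).iid n).mono ?_
      have hrew : (1 + ((1 + γ ^ 2 / d) ^ m - 1)) ^ n = (1 + γ ^ 2 / d) ^ (m * n) := by
        rw [add_sub_cancel, ← pow_mul]
      rw [hrew]
      -- Here the negated claim enters: `400 * α ^ 2 * m * n < 400 * d / 80000`.
      have hsmall : ((m * n : ℕ) : ℝ) * (γ ^ 2 / d) ≤ 1 / 200 := by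
        rw [mul_div_assoc', div_le_iff₀ hdR, hγ]
        push_cast
        linarith
      have := one_add_pow_sub_one_le (t := γ ^ 2 / d) (by positivity) (m * n) (by linarith)
      linarith
    set F : (Fin n → Fin m → X × Bool) → ℝ :=
      fun z => ((A z).toOuterMeasure {h | h x = true}).toReal with hF
    have hF01 : ∀ z, 0 ≤ F z ∧ F z ≤ 1 := fun z => ⟨ENNReal.toReal_nonneg, by
      have := ENNReal.toReal_mono ENNReal.one_ne_top (toOuterMeasure_le_one (A z) {h | h x = true})
      simpa using this⟩
    have hFb : IsBdd F := isBdd_of_mem_Icc hF01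
    have hsqrt : √(1 / 100 : ℝ) = 1 / 10 := by
      rw [show (1 / 100 : ℝ) = (1 / 10) ^ 2 by norm_num, Real.sqrt_sq (by norm_num)]
    have k1 := (hchi (insert x U) fun y hy => by simp [hu, hy]).mean_le (by norm_num)
      (F := F) (a := 0) (b := 1) hF01
    have k2 := (hchi U fun y _ => rfl).mean_le (by norm_num)
      (F := fun z => 1 - F z) (a := 0) (b := 1)
      fun z => ⟨by linarith [(hF01 z).2], by linarith [(hF01 z).1]⟩
    rw [mean_sub _ (isBdd_const 1) hFb, mean_sub _ (isBdd_const 1) hFb, mean_const, mean_const,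
      hsqrt] at k2
    rw [hsqrt] at k1
    have e1 : e U x = mean (iid n (iid m (D U))) F := by
      rw [hF, mean_bind_toReal]
      simp [he, hu, hxU, hR]
    have e2 : e (insert x U) x = 1 - mean (iid n (iid m (D (insert x U)))) F := by
      rw [hF, mean_bind_toReal]
      have hcompl : {h : X → Bool | h x ≠ u (insert x U) x} = {h : X → Bool | h x = true}ᶜ := by
        ext h; simp [hu]
      simp only [he, hcompl]
      rw [toOuterMeasure_compl, ENNReal.toReal_sub_of_le (toOuterMeasure_le_one _ _)
        ENNReal.one_ne_top, ENNReal.toReal_one]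
    rw [e1, e2]
    linarith
  have hdouble : ∑ x ∈ S, ∑ U ∈ S.powerset, e U x ≤ 2 ^ d * (23 / 60 * d) := by
    rw [Finset.sum_comm]
    calc ∑ U ∈ S.powerset, ∑ x ∈ S, e U x ≤ ∑ _U ∈ S.powerset, 23 / 60 * (d : ℝ) :=
          Finset.sum_le_sum fun U _ => hupper U
      _ = _ := by simp [Finset.card_powerset, hd]
  have hper : ∀ x ∈ S, (2 ^ (d - 1) : ℝ) * (4 / 5) ≤ ∑ U ∈ S.powerset, e U x := by
    intro x hx
    rw [← Finset.insert_erase hx, Finset.sum_powerset_insert (Finset.notMem_erase x S),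
      ← Finset.sum_add_distrib]
    calc (2 ^ (d - 1) : ℝ) * (4 / 5) = ∑ _U ∈ (S.erase x).powerset, (4 / 5 : ℝ) := by
          rw [Finset.sum_const, Finset.card_powerset, Finset.card_erase_of_mem hx, nsmul_eq_mul]
          push_cast
          rfl
      _ ≤ _ := Finset.sum_le_sum (hlower x hx)
  have htot : d * ((2 ^ (d - 1) : ℝ) * (4 / 5)) ≤ ∑ x ∈ S, ∑ U ∈ S.powerset, e U x := by
    calc d * ((2 ^ (d - 1) : ℝ) * (4 / 5)) = ∑ _x ∈ S, (2 ^ (d - 1) : ℝ) * (4 / 5) := by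
          rw [Finset.sum_const, nsmul_eq_mul]
      _ ≤ _ := Finset.sum_le_sum hper
  -- The contradiction: the average error per point and labelling is at least `2 / 5 = 24 / 60`, but
  -- at most `23 / 60`.
  have hpow : (2 : ℝ) ^ d = 2 * 2 ^ (d - 1) := by
    rw [← pow_succ', Nat.sub_add_cancel hd0]
  rw [hpow] at hdouble
  have hpos : (0 : ℝ) < d * 2 ^ (d - 1) := by positivity
  nlinarith

end VC

/-! ### Assembling the lower bound -/

section LowerBound

variable {X : Type*} {C : Set (X → Bool)}

/-- A one-concept class needs no users, so its rate has to vanish; the bounds obtained from two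
distinct concepts do not cover it. -/
theorem prDim_eq_zero_of_singleton (c : X → Bool) : prDim {c} = 0 := by
  refine le_antisymm (iInf₂_le_of_le (PMF.pure {c}) ?_ ?_) zero_le
  · intro c' hc' D
    rw [Set.mem_singleton_iff] at hc'
    subst hc'
    rw [PMF.toOuterMeasure_pure_apply, if_pos ⟨c', Finset.mem_singleton_self _, by simp⟩,
      ENNReal.ofReal_le_one]
    norm_num
  · refine iSup₂_le fun H hH => ?_
    rw [PMF.mem_support_pure_iff] at hH
    simp [hH]

theorem vcDim_eq_zero_of_singleton (c : X → Bool) : vcDim {c} = 0 := by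
  refine le_antisymm (iSup₂_le fun S hS => ?_) zero_le
  have hSe : S = ∅ := by
    refine Finset.eq_empty_of_forall_notMem fun x hx => ?_
    obtain ⟨c', hc', h⟩ := hS fun x => !(c x)
    rw [Set.mem_singleton_iff] at hc'
    subst hc'
    have := h x hx
    simp at this
  simp [hSe]

theorem vcDim_le_ofReal {B : ℝ} (hB : 0 ≤ B)
    (h : ∀ S : Finset X, Shatters C S → (S.card : ℝ) ≤ B) :
    ((vcDim C : ℕ∞) : ℝ≥0∞) ≤ ENNReal.ofReal B := by
  have h1 : vcDim C ≤ (⌊B⌋₊ : ℕ∞) := by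
    refine iSup₂_le fun S hS => ?_
    exact_mod_cast Nat.le_floor (h S hS)
  have h2 : ((vcDim C : ℕ∞) : ℝ≥0∞) ≤ ((⌊B⌋₊ : ℕ∞) : ℝ≥0∞) := ENat.toENNReal_le.2 h1
  refine h2.trans ?_
  rw [ENat.toENNReal_coe, ← ENNReal.ofReal_natCast]
  exact ENNReal.ofReal_le_ofReal (Nat.floor_le hB)

theorem exists_algorithm_of_userComplexity {Z O : Type*} {Ψ : PMF Z → Set O} {m : ℕ} {ε δ γ : ℝ}
    (h : userComplexity Ψ m ε δ γ ≠ ⊤) :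
    ∃ n : ℕ, userComplexity Ψ m ε δ γ = n ∧
      ∃ A : Algorithm n m Z O, IsUserLevelDP A ε δ ∧ IsUseful A Ψ γ := by
  classical
  have hex : ∃ n : ℕ, ∃ A : Algorithm n m Z O, IsUserLevelDP A ε δ ∧ IsUseful A Ψ γ := by
    by_contra hcon
    push Not at hcon
    refine h (iInf₂_eq_top.2 fun n ⟨A, hA⟩ => ?_)
    exact absurd hA.2 (hcon n A hA.1)
  refine ⟨Nat.find hex, le_antisymm (iInf₂_le (Nat.find hex) (Nat.find_spec hex)) ?_, Nat.find_spec hex⟩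
  exact le_iInf₂ fun n hn => by exact_mod_cast Nat.find_min' hex hn

/-- The three terms are bounded separately, with constants 3, 1280 and 80000; no logarithm is lost.
-/
theorem rate_le_userComplexity (hC : C.Nonempty) {α ε : ℝ} (hα : 0 < α) (hα1 : α ≤ 1 / 40)
    (hε : 0 < ε) (hε1 : ε ≤ 1) {m : ℕ} (hm : 1 ≤ m) :
    rate (prDim C) ((vcDim C : ℕ∞) : ℝ≥0∞) α ε m ≤
      ENNReal.ofReal 81283 *
        ((userComplexity (agnostic C α) m ε 0 (2 / 3) : ℕ∞) : ℝ≥0∞) := by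
  by_cases htop : userComplexity (agnostic C α) m ε 0 (2 / 3) = ⊤
  · rw [htop, ENat.toENNReal_top, ENNReal.mul_top]
    · exact le_top
    · simp
  obtain ⟨n, hn, A, hA, hU⟩ := exists_algorithm_of_userComplexity htop
  rw [hn, ENat.toENNReal_coe]
  obtain ⟨c₁, h₁⟩ := hC
  by_cases hsub : ∃ c₂ ∈ C, c₁ ≠ c₂
  · obtain ⟨c₂, h₂, hne⟩ := hsub
    have hm0 : (0 : ℝ) < m := by exact_mod_cast hm
    have b1 : prDim C / ENNReal.ofReal ε ≤ ENNReal.ofReal (3 * n) := by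
      refine ENNReal.div_le_of_le_mul ?_
      rw [← ENNReal.ofReal_mul (by positivity)]
      refine (prDim_le_of_useful (by linarith) hA hU h₁ h₂ hne).trans (le_of_eq ?_)
      congr 1
      ring
    have b2 : ((vcDim C : ℕ∞) : ℝ≥0∞) / ENNReal.ofReal (α * ε * √(m : ℝ)) ≤
        ENNReal.ofReal (1280 * n) := by
      refine ENNReal.div_le_of_le_mul ?_
      rw [← ENNReal.ofReal_mul (by positivity)]
      refine vcDim_le_ofReal (by positivity) fun S hS => ?_
      rcases S.eq_empty_or_nonempty with rfl | hne
      · simp only [Finset.card_empty, Nat.cast_zero]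
        positivity
      · have := card_le_of_private hm hα hα1 hε hε1 hA hU hne hS
        linarith
    have b3 : ((vcDim C : ℕ∞) : ℝ≥0∞) / ENNReal.ofReal (α ^ 2 * m) ≤
        ENNReal.ofReal (80000 * n) := by
      refine ENNReal.div_le_of_le_mul ?_
      rw [← ENNReal.ofReal_mul (by positivity)]
      refine vcDim_le_ofReal (by positivity) fun S hS => ?_
      rcases S.eq_empty_or_nonempty with rfl | hne
      · simp only [Finset.card_empty, Nat.cast_zero]
        positivity
      · have := card_le_of_useful hα hα1 hU hne hS
        linarith
    refine (add_le_add (add_le_add b1 b2) b3).trans (le_of_eq ?_)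
    rw [← ENNReal.ofReal_add (by positivity) (by positivity),
      ← ENNReal.ofReal_add (by positivity) (by positivity), ← ENNReal.ofReal_natCast,
      ← ENNReal.ofReal_mul (by norm_num)]
    congr 1
    ring
  · push Not at hsub
    have hCs : C = {c₁} := Set.eq_singleton_iff_unique_mem.2 ⟨h₁, fun c hc => (hsub c hc).symm⟩
    rw [hCs, prDim_eq_zero_of_singleton, vcDim_eq_zero_of_singleton]
    simp [rate]

end LowerBound

/-! ### Boosting probabilistic representations -/

section Boosting

variable {X : Type*}

open Classical in
/-- Lists of hypotheses, one from each of `t` independent draws of a class (enlarged by a default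
hypothesis). -/
def boost (P : PMF (Finset (X → Bool))) : ℕ → PMF (Finset (List (X → Bool)))
  | 0 => PMF.pure {[]}
  | t + 1 => P.bind fun H =>
      (boost P t).map fun 𝓛 => Finset.image₂ List.cons (insert (fun _ => false) H) 𝓛

/-- The factor by which a hypothesis changes the weight of a point. -/
def factor (c h : X → Bool) (x : X) : ℝ≥0∞ :=
  if h x = c x then ENNReal.ofReal (8 / 9) else ENNReal.ofReal (9 / 8)

/-- The weight of a point after reweighting by all hypotheses of a list. -/
def weight (c : X → Bool) (l : List (X → Bool)) (x : X) : ℝ≥0∞ :=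
  (l.map fun h => factor c h x).prod

/-- The smallest total weight over a set of lists. -/
def minWeight (c : X → Bool) (w : X → ℝ≥0∞) (𝓛 : Finset (List (X → Bool))) : ℝ≥0∞ :=
  ⨅ l ∈ 𝓛, ∑' x, w x * weight c l x

open Classical in
theorem tsum_mul_factor (c h : X → Bool) (D : PMF X) (W : ℝ≥0∞) :
    ∑' x, (W * D x) * factor c h x =
      W * (ENNReal.ofReal (8 / 9) +
        ENNReal.ofReal (17 / 72) * D.toOuterMeasure {x | c x ≠ h x}) := by
  have h1 : ∀ x, factor c h x =
      ENNReal.ofReal (8 / 9) + ENNReal.ofReal (17 / 72) * {x | c x ≠ h x}.indicator 1 x := by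
    intro x
    by_cases hx : h x = c x
    · rw [factor, if_pos hx, Set.indicator_of_notMem (by simp [hx]), mul_zero, add_zero]
    · rw [factor, if_neg hx, Set.indicator_of_mem (by simpa using Ne.symm hx), Pi.one_apply,
        mul_one, ← ENNReal.ofReal_add (by norm_num) (by norm_num)]
      norm_num
  simp_rw [mul_assoc, ENNReal.tsum_mul_left, h1]
  congr 1
  change expect D _ = _
  rw [expect_add, expect_const, expect_const_mul, toOuterMeasure_eq_expect]

-- Normalize `w` to a distribution. With probability at least 3/4 some drawn hypothesis errs on at
-- most a quarter of it; otherwise the default one is bounded trivially. The expected error bound `7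
-- / 16` gives `8 / 9 + (17 / 72) * (7 / 16) = 127 / 128`.
open Classical in
theorem expect_iInf_factor_le {P : PMF (Finset (X → Bool))} {C : Set (X → Bool)}
    (hP : IsPR P C (1 / 4) (1 / 4)) {c : X → Bool} (hc : c ∈ C) (w : X → ℝ≥0∞) :
    (expect P fun H => ⨅ h ∈ insert (fun _ => false) H, ∑' x, w x * factor c h x) ≤
      ENNReal.ofReal (127 / 128) * ∑' x, w x := by
  by_cases hW0 : ∑' x, w x = 0
  · rw [hW0, mul_zero, nonpos_iff_eq_zero]
    rw [← expect_const P 0]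
    congr 1
    funext H
    refine le_antisymm (iInf₂_le_of_le _ (Finset.mem_insert_self _ H) (le_of_eq ?_)) zero_le
    rw [ENNReal.tsum_eq_zero] at hW0 ⊢
    exact fun x => by rw [hW0 x, zero_mul]
  by_cases hWt : ∑' x, w x = ⊤
  · rw [hWt, ENNReal.mul_top (by simp)]
    exact le_top
  set W := ∑' x, w x with hW
  set D := PMF.normalize w hW0 hWt with hD
  have hw : ∀ x, w x = W * D x := fun x => by
    rw [hD, PMF.normalize_apply, mul_comm (w x), ← mul_assoc, ENNReal.mul_inv_cancel hW0 hWt,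
      one_mul]
  set G : Set (Finset (X → Bool)) :=
    {H | ∃ h ∈ H, D.toOuterMeasure {x | c x ≠ h x} ≤ ENNReal.ofReal (1 / 4)} with hG
  have hbad : P.toOuterMeasure Gᶜ ≤ ENNReal.ofReal (1 / 4) := by
    rw [toOuterMeasure_compl, tsub_le_iff_right]
    refine le_trans ?_ (add_le_add_right (hP c hc D) _)
    rw [← ENNReal.ofReal_add (by norm_num) (by norm_num)]
    norm_num
  have hstep : ∀ H : Finset (X → Bool),
      (⨅ h ∈ insert (fun _ => false) H, ∑' x, w x * factor c h x) ≤
      W * (ENNReal.ofReal (8 / 9) + ENNReal.ofReal (17 / 72) *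
        (ENNReal.ofReal (1 / 4) + ENNReal.ofReal (3 / 4) * Gᶜ.indicator 1 H)) := fun H => by
    simp_rw [hw, tsum_mul_factor]
    by_cases hH : H ∈ G
    · obtain ⟨h, hhH, hh⟩ := hH
      refine iInf₂_le_of_le h (Finset.mem_insert_of_mem hhH) ?_
      gcongr
      exact hh.trans le_self_add
    · refine iInf₂_le_of_le _ (Finset.mem_insert_self _ H) ?_
      gcongr
      rw [Set.indicator_of_mem (by exact hH), Pi.one_apply, mul_one,
        ← ENNReal.ofReal_add (by norm_num) (by norm_num)]
      refine (toOuterMeasure_le_one _ _).trans ?_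
      norm_num
  refine (expect_mono hstep).trans ?_
  rw [expect_const_mul, expect_add, expect_const_mul, expect_add, expect_const_mul, expect_const,
    expect_const, ← toOuterMeasure_eq_expect, mul_comm]
  gcongr
  calc _ ≤ ENNReal.ofReal (8 / 9) + ENNReal.ofReal (17 / 72) *
      (ENNReal.ofReal (1 / 4) + ENNReal.ofReal (3 / 4) * ENNReal.ofReal (1 / 4)) := by gcongr
    _ = _ := by
      rw [← ENNReal.ofReal_mul (by norm_num), ← ENNReal.ofReal_add (by norm_num) (by norm_num),
        ← ENNReal.ofReal_mul (by norm_num), ← ENNReal.ofReal_add (by norm_num) (by norm_num)]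
      norm_num

-- After the first class is drawn, its best hypothesis reweights the points, and the remaining
-- independent draws face the new weights. This is why `w` is arbitrary in the induction. All lists
-- are kept, so the best choices need not be known.
open Classical in
theorem expect_boost_le {P : PMF (Finset (X → Bool))} {C : Set (X → Bool)}
    (hP : IsPR P C (1 / 4) (1 / 4)) {c : X → Bool} (hc : c ∈ C) :
    ∀ (t : ℕ) (w : X → ℝ≥0∞),
      expect (boost P t) (minWeight c w) ≤ ENNReal.ofReal (127 / 128) ^ t * ∑' x, w x
  | 0, w => by
    rw [boost, expect_pure, minWeight]
    simp [weight]
  | t + 1, w => by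
    rw [boost, expect_bind]
    simp_rw [expect_map]
    have h1 : ∀ H : Finset (X → Bool),
        (expect (boost P t) fun 𝓛 =>
          minWeight c w (Finset.image₂ List.cons (insert (fun _ => false) H) 𝓛)) ≤
        ENNReal.ofReal (127 / 128) ^ t *
          ⨅ h ∈ insert (fun _ => false) H, ∑' x, w x * factor c h x := fun H => by
      obtain ⟨h, hh, hmin⟩ := Finset.exists_min_image (insert (fun _ => false) H)
        (fun h => ∑' x, w x * factor c h x) ⟨_, Finset.mem_insert_self _ _⟩
      calc _ ≤ expect (boost P t) (minWeight c fun x => w x * factor c h x) := by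
            refine expect_mono fun 𝓛 => le_iInf₂ fun l hl => ?_
            refine iInf₂_le_of_le (h :: l) (Finset.mem_image₂_of_mem hh hl) (le_of_eq ?_)
            refine tsum_congr fun x => ?_
            simp [weight, mul_assoc]
        _ ≤ ENNReal.ofReal (127 / 128) ^ t * ∑' x, w x * factor c h x :=
            expect_boost_le hP hc t _
        _ ≤ _ := by
            gcongr
            exact le_iInf₂ hmin
    refine (expect_mono h1).trans ?_
    rw [expect_const_mul, pow_succ, mul_assoc]
    gcongr
    exact expect_iInf_factor_le hP hc w

/-- The majority vote of a list of hypotheses. -/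
def majority (l : List (X → Bool)) (x : X) : Bool :=
  decide (l.length < 2 * l.countP fun h => h x)

theorem weight_eq (c : X → Bool) (l : List (X → Bool)) (x : X) :
    weight c l x = ENNReal.ofReal (9 / 8) ^ (l.countP fun h => h x != c x) *
      ENNReal.ofReal (8 / 9) ^ (l.countP fun h => h x == c x) := by
  induction l with
  | nil => simp [weight]
  | cons h l ih =>
    have : weight c (h :: l) x = factor c h x * weight c l x := by simp [weight]
    rw [this, ih, List.countP_cons, List.countP_cons, factor]
    by_cases hx : h x = c x
    · simp only [hx, if_true, bne_self_eq_false, beq_self_eq_true, Bool.false_eq_true, if_false,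
        add_zero, pow_succ]
      ring
    · simp only [hx, if_false, bne_iff_ne, ne_eq, not_false_eq_true, if_true, beq_iff_eq,
        add_zero, pow_succ]
      ring

/-- If the vote is wrong, ties included, at least as many hypotheses err at `x` as are right; the
factors `9 / 8` and `8 / 9` are reciprocal. -/
theorem one_le_weight {c : X → Bool} {l : List (X → Bool)} {x : X} (h : c x ≠ majority l x) :
    1 ≤ weight c l x := by
  have hlen : l.length = (l.countP fun h => h x != c x) + l.countP fun h => h x == c x := by
    rw [List.length_eq_countP_add_countP (fun h => h x != c x)]
    congr 2
    funext h
    cases h x <;> cases c x <;> rfl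
  have hle : (l.countP fun h => h x == c x) ≤ l.countP fun h => h x != c x := by
    cases hc : c x
    · have h1 : majority l x = true := by
        cases hm : majority l x
        · exact absurd (hc.trans hm.symm) h
        · rfl
      rw [majority, decide_eq_true_iff] at h1
      rw [hc] at hlen
      have h2 : (l.countP fun h => h x != false) = l.countP fun h => h x := by
        congr 1; funext h; cases h x <;> rfl
      rw [h2] at hlen ⊢
      omega
    · have h1 : majority l x = false := by
        cases hm : majority l x
        · rfl
        · exact absurd (hc.trans hm.symm) h
      rw [majority, decide_eq_false_iff_not] at h1
      rw [hc] at hlen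
      have h2 : (l.countP fun h => h x == true) = l.countP fun h => h x := by
        congr 1; funext h; cases h x <;> rfl
      rw [h2] at hlen ⊢
      omega
  rw [weight_eq]
  calc (1 : ℝ≥0∞) = (ENNReal.ofReal (9 / 8) * ENNReal.ofReal (8 / 9)) ^
        (l.countP fun h => h x == c x) := by
        rw [← ENNReal.ofReal_mul (by norm_num)]; norm_num
    _ = ENNReal.ofReal (9 / 8) ^ (l.countP fun h => h x == c x) *
        ENNReal.ofReal (8 / 9) ^ (l.countP fun h => h x == c x) := mul_pow _ _ _
    _ ≤ _ := by
      gcongr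
      rw [ENNReal.one_le_ofReal]; norm_num

open Classical in
/-- The classes of majority votes over `t` independent draws of a class. -/
def boosted (P : PMF (Finset (X → Bool))) (t : ℕ) : PMF (Finset (X → Bool)) :=
  (boost P t).map fun 𝓛 => 𝓛.image majority

/-- The total weight of a list dominates the error of its majority vote, so failure forces the
minimal weight above `η`; Markov's inequality applies. -/
theorem boosted_compl_le {P : PMF (Finset (X → Bool))} {C : Set (X → Bool)}
    (hP : IsPR P C (1 / 4) (1 / 4)) {c : X → Bool} (hc : c ∈ C) (D : PMF X) {η : ℝ} (hη : 0 < η)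
    (t : ℕ) :
    (boosted P t).toOuterMeasure
        {H | ∃ h ∈ H, D.toOuterMeasure {x | c x ≠ h x} ≤ ENNReal.ofReal η}ᶜ ≤
      ENNReal.ofReal ((127 / 128) ^ t / η) := by
  classical
  have hη' : ENNReal.ofReal η ≠ 0 := by
    rw [Ne, ENNReal.ofReal_eq_zero]; linarith
  rw [boosted, PMF.toOuterMeasure_map_apply]
  calc _ ≤ expect (boost P t) fun 𝓛 => (ENNReal.ofReal η)⁻¹ * minWeight c D 𝓛 := by
        refine toOuterMeasure_le_expect fun 𝓛 h𝓛 => ?_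
        have h1 : ENNReal.ofReal η ≤ minWeight c D 𝓛 := by
          refine le_iInf₂ fun l hl => ?_
          have h2 : ENNReal.ofReal η ≤ D.toOuterMeasure {x | c x ≠ majority l x} := by
            by_contra hcon
            exact h𝓛 ⟨majority l, Finset.mem_image_of_mem _ hl, (not_le.1 hcon).le⟩
          exact h2.trans (toOuterMeasure_le_expect fun x hx => one_le_weight hx)
        rw [← ENNReal.inv_mul_cancel hη' ENNReal.ofReal_ne_top]
        gcongr
    _ ≤ (ENNReal.ofReal η)⁻¹ * (ENNReal.ofReal (127 / 128) ^ t * ∑' x, D x) := by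
        rw [expect_const_mul]
        gcongr
        exact expect_boost_le hP hc t D
    _ = _ := by
        rw [D.tsum_coe, mul_one, ← ENNReal.ofReal_pow (by norm_num), mul_comm, ← div_eq_mul_inv,
          ENNReal.ofReal_div_of_pos hη]

theorem nonempty_and_card_le_of_mem_support_boosted {P : PMF (Finset (X → Bool))} {M : ℕ}
    (hM : ∀ H ∈ P.support, H.card + 1 ≤ M) {t : ℕ} {H : Finset (X → Bool)}
    (hH : H ∈ (boosted P t).support) : H.Nonempty ∧ H.card ≤ M ^ t := by
  classical
  have key : ∀ (t : ℕ) (𝓛 : Finset (List (X → Bool))), 𝓛 ∈ (boost P t).support →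
      𝓛.Nonempty ∧ 𝓛.card ≤ M ^ t := by
    intro t
    induction t with
    | zero =>
      intro 𝓛 h𝓛
      rw [boost, PMF.mem_support_pure_iff] at h𝓛
      subst h𝓛
      simp
    | succ t ih =>
      intro 𝓛 h𝓛
      rw [boost, PMF.mem_support_bind_iff] at h𝓛
      obtain ⟨H, hH, h𝓛⟩ := h𝓛
      rw [PMF.mem_support_map_iff] at h𝓛
      obtain ⟨𝓛', h𝓛', rfl⟩ := h𝓛
      obtain ⟨hne, hcard⟩ := ih 𝓛' h𝓛'
      refine ⟨Finset.image₂_nonempty_iff.2 ⟨⟨_, Finset.mem_insert_self _ _⟩, hne⟩, ?_⟩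
      refine (Finset.card_image₂_le _ _ _).trans ?_
      rw [pow_succ, mul_comm]
      exact Nat.mul_le_mul hcard ((Finset.card_insert_le _ _).trans (hM H hH))
  rw [boosted, PMF.mem_support_map_iff] at hH
  obtain ⟨𝓛, h𝓛, rfl⟩ := hH
  obtain ⟨hne, hcard⟩ := key t 𝓛 h𝓛
  exact ⟨hne.image _, Finset.card_image_le.trans hcard⟩

end Boosting

/-! ### Concentration of sums of clipped averages -/

section Clip

/-- Truncation of a real number to `[-B, B]`. -/
def clip (B v : ℝ) : ℝ := max (-B) (min B v)

theorem abs_clip_le {B : ℝ} (hB : 0 ≤ B) (v : ℝ) : |clip B v| ≤ B :=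
  abs_le.2 ⟨le_max_left _ _, max_le (by linarith) (min_le_left _ _)⟩

theorem clip_mono (B : ℝ) {v w : ℝ} (h : v ≤ w) : clip B v ≤ clip B w :=
  max_le_max le_rfl (min_le_min le_rfl h)

theorem clip_neg {B : ℝ} (hB : 0 ≤ B) (v : ℝ) : clip B (-v) = -clip B v := by
  simp only [clip]
  rcases le_total v (-B) with h1 | h1
  · rw [min_eq_left (by linarith : B ≤ -v), min_eq_right (by linarith : v ≤ B), max_eq_left h1,
      max_eq_right (by linarith : -B ≤ B)]
    ring
  · rcases le_total v B with h2 | h2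
    · rw [min_eq_right (by linarith : -v ≤ B), min_eq_right h2, max_eq_right h1,
        max_eq_right (by linarith : -B ≤ -v)]
    · rw [min_eq_left h2, min_eq_right (by linarith : -v ≤ B),
        max_eq_left (by linarith : -v ≤ -B), max_eq_right (by linarith : -B ≤ B)]

/-- Only the truncation at `-B` can raise a value. The exponential majorant makes the mean of that
rise computable over independent samples. -/
theorem clip_le_add_exp {B l : ℝ} (hl : 0 < l) (v : ℝ) :
    clip B v ≤ v + Real.exp (l * (-B - v)) / l := by
  have h0 : 0 < Real.exp (l * (-B - v)) / l := by positivity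
  refine max_le ?_ ((min_le_right _ _).trans (by linarith))
  have h1 : -B - v ≤ Real.exp (l * (-B - v)) / l := by
    rw [le_div_iff₀ hl]
    linarith [Real.add_one_le_exp (l * (-B - v))]
  linarith

theorem exp_le_one_add_add_sq {v : ℝ} (h : |v| ≤ 1) : Real.exp v ≤ 1 + v + v ^ 2 := by
  have := Real.abs_exp_sub_one_sub_id_le h
  linarith [le_abs_self (Real.exp v - 1 - v)]

end Clip

section Concentration

variable {Z : Type*}

theorem isBdd_exp {f : Z → ℝ} (hf : IsBdd f) : IsBdd fun x => Real.exp (f x) := by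
  obtain ⟨M, hM⟩ := hf
  refine ⟨Real.exp M, fun x => ?_⟩
  rw [abs_of_pos (Real.exp_pos _)]
  exact Real.exp_le_exp.2 ((le_abs_self _).trans (hM x))

/-- Chernoff bound for sums of independent bounded variables. -/
theorem iid_sum_ge_le {q : PMF Z} {V : Z → ℝ} {B a μ : ℝ} (ha : 0 < a) (haB : a ≤ B)
    (hV : ∀ x, |V x| ≤ B) (hmean : mean q V ≤ μ + a / 8) (n : ℕ) :
    (iid n q).toOuterMeasure {x | n * (μ + a / 4) ≤ ∑ i, V (x i)} ≤
      ENNReal.ofReal (Real.exp (-(n * (a ^ 2 / (256 * B ^ 2))))) := by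
  have hB : 0 < B := ha.trans_le haB
  have hVb : IsBdd V := ⟨B, hV⟩
  -- The minimizer of the exponent `-θ * a / 8 + θ ^ 2 * B ^ 2`, with minimum `-a ^ 2 / (256 * B ^
  -- 2)`.
  set θ := a / (16 * B ^ 2) with hθ
  have hθ0 : 0 < θ := by positivity
  have hθB : θ * B ≤ 1 := by
    have : θ * B = a / (16 * B) := by rw [hθ]; field_simp
    rw [this, div_le_one (by positivity)]
    linarith
  have hexp : mean q (fun x => Real.exp (θ * V x)) ≤
      Real.exp (θ * (μ + a / 8) + θ ^ 2 * B ^ 2) := by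
    calc mean q (fun x => Real.exp (θ * V x))
        ≤ mean q (fun x => (1 + θ ^ 2 * B ^ 2) + θ * V x) := by
          refine mean_mono q (isBdd_exp ((isBdd_const θ).mul hVb))
            ((isBdd_const _).add ((isBdd_const θ).mul hVb)) fun x => ?_
          have h1 : |θ * V x| ≤ θ * B := by
            rw [abs_mul, abs_of_pos hθ0]
            exact mul_le_mul_of_nonneg_left (hV x) hθ0.le
          have h2 := exp_le_one_add_add_sq (h1.trans hθB)
          have h3 : (θ * V x) ^ 2 ≤ (θ * B) ^ 2 := sq_le_sq' (abs_le.1 h1).1 (abs_le.1 h1).2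
          linarith [mul_pow θ B 2]
      _ = (1 + θ ^ 2 * B ^ 2) + θ * mean q V := by
          rw [mean_add q (isBdd_const _) ((isBdd_const θ).mul hVb), mean_const, mean_const_mul]
      _ ≤ (θ * (μ + a / 8) + θ ^ 2 * B ^ 2) + 1 := by nlinarith
      _ ≤ _ := Real.add_one_le_exp _
  have hprod : ∀ x : Fin n → Z, Real.exp (-(θ * (n * (μ + a / 4)))) *
      ∏ i, Real.exp (θ * V (x i)) = Real.exp (θ * (∑ i, V (x i) - n * (μ + a / 4))) := fun x => by
    rw [← Real.exp_sum, ← Real.exp_add, ← Finset.mul_sum]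
    congr 1
    ring
  calc _ ≤ expect (iid n q) fun x =>
        ENNReal.ofReal (Real.exp (-(θ * (n * (μ + a / 4))))) *
          ∏ i, ENNReal.ofReal (Real.exp (θ * V (x i))) := by
        refine toOuterMeasure_le_expect fun x hx => ?_
        rw [← ENNReal.ofReal_prod_of_nonneg fun _ _ => (Real.exp_pos _).le,
          ← ENNReal.ofReal_mul (Real.exp_pos _).le, hprod, ENNReal.one_le_ofReal,
          Real.one_le_exp_iff]
        exact mul_nonneg hθ0.le (sub_nonneg.2 hx)
    _ = ENNReal.ofReal (Real.exp (-(θ * (n * (μ + a / 4)))) *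
          mean q (fun x => Real.exp (θ * V x)) ^ n) := by
        rw [expect_const_mul, expect_iid_prod n q fun _ x => ENNReal.ofReal (Real.exp (θ * V x)),
          Finset.prod_const, expect_ofReal q (isBdd_exp ((isBdd_const θ).mul hVb))
            (fun x => (Real.exp_pos _).le), Finset.card_univ, Fintype.card_fin,
          ← ENNReal.ofReal_pow (mean_nonneg q fun x => (Real.exp_pos _).le),
          ← ENNReal.ofReal_mul (Real.exp_pos _).le]
    _ ≤ _ := by
        refine ENNReal.ofReal_le_ofReal ?_
        calc _ ≤ Real.exp (-(θ * (n * (μ + a / 4)))) *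
              Real.exp (θ * (μ + a / 8) + θ ^ 2 * B ^ 2) ^ n := by
              refine mul_le_mul_of_nonneg_left ?_ (Real.exp_pos _).le
              exact pow_le_pow_left₀ (mean_nonneg q fun x => (Real.exp_pos _).le) hexp n
          _ = _ := by
              rw [← Real.exp_nat_mul, ← Real.exp_add]
              congr 1
              rw [hθ]
              field_simp
              ring

/-- The mean of a clipped average exceeds the true mean only slightly. -/
theorem mean_clip_average_le {D : PMF Z} {g : Z → ℝ} (hg : ∀ z, |g z| ≤ 1) {a μ B : ℝ}
    (ha : 0 < a) (hμ : mean D g ≤ μ) (hμa : -a ≤ μ) {m : ℕ} (hm : 1 ≤ m)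
    (hB : a + 2 * (1 + Real.log (16 / a)) / √m ≤ B) (hB0 : 0 ≤ B) :
    mean (iid m D) (fun x => clip B ((∑ j, g (x j)) / m)) ≤ μ + a / 8 := by
  have hgb : IsBdd g := ⟨1, hg⟩
  have hm0 : (0 : ℝ) < m := by exact_mod_cast hm
  set s := √(m : ℝ) with hs
  have hs1 : 1 ≤ s := by
    rw [hs, Real.one_le_sqrt]; exact_mod_cast hm
  have hs0 : 0 < s := by linarith
  have hss : s * s = m := Real.mul_self_sqrt hm0.le
  set ν := mean D g with hν
  have hνabs : |ν| ≤ 1 := by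
    have h1 := mean_mono D hgb (isBdd_const 1) fun z => (abs_le.1 (hg z)).2
    have h2 := mean_mono D (isBdd_const (-1)) hgb fun z => (abs_le.1 (hg z)).1
    rw [mean_const] at h1 h2
    exact abs_le.2 ⟨h2, h1⟩
  set u : (Fin m → Z) → ℝ := fun x => (∑ j, g (x j)) / m with hu
  have hgj : ∀ j : Fin m, IsBdd fun x : Fin m → Z => g (x j) := fun j => ⟨1, fun x => hg _⟩
  have hub : IsBdd u := by
    have := (isBdd_const (Ω := Fin m → Z) (1 / (m : ℝ))).mul
      (IsBdd.sum Finset.univ fun j _ => hgj j)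
    simpa [hu, div_eq_inv_mul] using this
  have hmu : mean (iid m D) u = ν := by
    have h1 : u = fun x => (1 / (m : ℝ)) * ∑ j, g (x j) := by
      funext x; simp only [hu]; ring
    rw [h1, mean_const_mul, mean_sum _ _ fun j _ => hgj j,
      Finset.sum_congr rfl fun j _ => mean_iid_apply m D hgb j]
    simp only [Finset.sum_const, Finset.card_univ, Fintype.card_fin, nsmul_eq_mul]
    rw [← mul_assoc, one_div_mul_cancel hm0.ne', one_mul]
  -- At the scale `1 / √m` the moment generating function of all `m` samples together stays below
  -- `exp 1`.
  set f : Z → ℝ := fun z => Real.exp (-(1 / (2 * s)) * (g z - ν)) with hf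
  have hfb : IsBdd f := isBdd_exp ((isBdd_const _).mul (hgb.sub (isBdd_const ν)))
  have hf0 : ∀ z, 0 ≤ f z := fun z => (Real.exp_pos _).le
  have hfmean : mean D f ≤ Real.exp (1 / m) := by
    have hdiff : IsBdd fun z => g z - ν := hgb.sub (isBdd_const ν)
    calc mean D f ≤ mean D fun z => (1 + 1 / m) + -(1 / (2 * s)) * (g z - ν) := by
          refine mean_mono D hfb ((isBdd_const _).add ((isBdd_const _).mul hdiff)) fun z => ?_
          have h1 : |-(1 / (2 * s)) * (g z - ν)| ≤ 1 / s := by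
            rw [abs_mul, abs_neg, abs_of_pos (by positivity)]
            have h2 : |g z - ν| ≤ 2 := (abs_sub _ _).trans (by linarith [hg z])
            calc 1 / (2 * s) * |g z - ν| ≤ 1 / (2 * s) * 2 :=
                  mul_le_mul_of_nonneg_left h2 (by positivity)
              _ = 1 / s := by field_simp
          have h3 : 1 / s ≤ 1 := by rw [div_le_one hs0]; exact hs1
          have h4 := exp_le_one_add_add_sq (h1.trans h3)
          have h5 : (-(1 / (2 * s)) * (g z - ν)) ^ 2 ≤ (1 / s) ^ 2 :=
            sq_le_sq' (abs_le.1 h1).1 (abs_le.1 h1).2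
          have h6 : (1 / s) ^ 2 = 1 / m := by
            rw [div_pow, one_pow, sq, hss]
          simp only [hf]
          linarith
      _ = 1 / m + 1 := by
          rw [mean_add D (isBdd_const _) ((isBdd_const _).mul hdiff), mean_const, mean_const_mul,
            mean_sub D hgb (isBdd_const ν), mean_const]
          ring
      _ ≤ _ := Real.add_one_le_exp _
  have hprodmean : (mean (iid m D) fun x => ∏ j, f (x j)) ≤ Real.exp 1 := by
    rw [mean_iid_prod m D hfb hf0]
    calc mean D f ^ m ≤ Real.exp (1 / m) ^ m := pow_le_pow_left₀ (mean_nonneg D hf0) hfmean m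
      _ = Real.exp 1 := by
        rw [← Real.exp_nat_mul]
        congr 1
        field_simp
  have hprodb : IsBdd fun x : Fin m → Z => ∏ j, f (x j) := by
    obtain ⟨M, hM⟩ := hfb
    refine ⟨∏ _j : Fin m, M, fun x => ?_⟩
    rw [Finset.abs_prod]
    exact Finset.prod_le_prod (fun _ _ => abs_nonneg _) fun i _ => hM _
  set κ := 2 / s * Real.exp (-(s / 2) * (B + μ)) with hκ
  have hκ0 : 0 ≤ κ := by positivity
  -- Shifting up to mean `μ ≥ -a` first is allowed by monotonicity of `clip`. Without it a very
  -- negative `ν` would make the truncation bias large.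
  have hpt : ∀ x, clip B (u x) ≤ (u x + (μ - ν)) + κ * ∏ j, f (x j) := fun x => by
    refine (clip_mono B (by linarith : u x ≤ u x + (μ - ν))).trans ?_
    refine (clip_le_add_exp (by positivity : 0 < s / 2) _).trans (le_of_eq ?_)
    congr 1
    have h1 : ∏ j, f (x j) = Real.exp (-(s / 2) * (u x - ν)) := by
      simp only [hf]
      rw [← Real.exp_sum, ← Finset.mul_sum, Finset.sum_sub_distrib, Finset.sum_const,
        Finset.card_univ, Fintype.card_fin, nsmul_eq_mul]
      congr 1
      simp only [hu]
      rw [← hss]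
      field_simp
    rw [h1, hκ, mul_assoc, ← Real.exp_add]
    have h2 : s / 2 * (-B - (u x + (μ - ν))) = -(s / 2) * (B + μ) + -(s / 2) * (u x - ν) := by
      ring
    rw [h2]
    field_simp
  have hclipb : IsBdd fun x => clip B (u x) := ⟨B, fun x => abs_clip_le hB0 _⟩
  have hmain := mean_mono (iid m D) hclipb
    ((hub.add (isBdd_const (μ - ν))).add ((isBdd_const κ).mul hprodb)) hpt
  rw [mean_add _ (hub.add (isBdd_const (μ - ν))) ((isBdd_const κ).mul hprodb),
    mean_add _ hub (isBdd_const _), mean_const, mean_const_mul, hmu] at hmain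
  have hκle : κ * Real.exp 1 ≤ a / 8 := by
    have h1 : 2 * (1 + Real.log (16 / a)) ≤ s * (B + μ) := by
      have : 2 * (1 + Real.log (16 / a)) / s ≤ B + μ := by linarith
      rwa [div_le_iff₀ hs0, mul_comm (B + μ)] at this
    have h2 : Real.exp (-(s / 2) * (B + μ)) * Real.exp 1 ≤ a / 16 := by
      rw [← Real.exp_add]
      calc Real.exp (-(s / 2) * (B + μ) + 1) ≤ Real.exp (-Real.log (16 / a)) :=
            Real.exp_le_exp.2 (by linarith)
        _ = a / 16 := by
            rw [Real.exp_neg, Real.exp_log (by positivity), inv_div]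
    have h3 : 2 / s ≤ 2 := by
      rw [div_le_iff₀ hs0]; linarith
    calc κ * Real.exp 1 = 2 / s * (Real.exp (-(s / 2) * (B + μ)) * Real.exp 1) := by
          rw [hκ]; ring
      _ ≤ 2 * (a / 16) := mul_le_mul h3 h2 (by positivity) (by norm_num)
      _ = a / 8 := by ring
  have h9 := mul_le_mul_of_nonneg_left hprodmean hκ0
  linarith

end Concentration

/-! ### The exponential mechanism -/

section ExpMech

variable {O : Type*}

theorem sum_exp_pos {H : Finset O} (hH : H.Nonempty) (s : O → ℝ) :
    0 < ∑ h ∈ H, Real.exp (-s h) := Finset.sum_pos (fun _ _ => Real.exp_pos _) hH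

open Classical in
/-- The exponential mechanism on the finite set `H` with (scaled) losses `s`. -/
def expMech (H : Finset O) (hH : H.Nonempty) (s : O → ℝ) : PMF O :=
  PMF.ofFinset
    (fun h => if h ∈ H then ENNReal.ofReal (Real.exp (-s h) / ∑ h ∈ H, Real.exp (-s h)) else 0) H
    (by
      rw [Finset.sum_congr rfl fun h hh => if_pos hh, ← ENNReal.ofReal_sum_of_nonneg fun h _ =>
        div_nonneg (Real.exp_pos _).le (sum_exp_pos hH s).le, ← Finset.sum_div,
        div_self (sum_exp_pos hH s).ne', ENNReal.ofReal_one])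
    (fun h hh => if_neg hh)

open Classical in
theorem expMech_apply (H : Finset O) (hH : H.Nonempty) (s : O → ℝ) (h : O) :
    expMech H hH s h =
      if h ∈ H then ENNReal.ofReal (Real.exp (-s h) / ∑ h ∈ H, Real.exp (-s h)) else 0 := rfl

/-- One factor `exp Δ` comes from the numerator and one from the normalizer. -/
theorem expMech_le {H : Finset O} (hH : H.Nonempty) {s s' : O → ℝ} {Δ : ℝ}
    (h : ∀ o ∈ H, |s o - s' o| ≤ Δ) (S : Set O) :
    (expMech H hH s).toOuterMeasure S ≤
      ENNReal.ofReal (Real.exp (2 * Δ)) * (expMech H hH s').toOuterMeasure S := by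
  classical
  rw [PMF.toOuterMeasure_apply, PMF.toOuterMeasure_apply, ← ENNReal.tsum_mul_left]
  refine ENNReal.tsum_le_tsum fun o => ?_
  by_cases ho : o ∈ S
  · rw [Set.indicator_of_mem ho, Set.indicator_of_mem ho, expMech_apply, expMech_apply]
    by_cases hoH : o ∈ H
    · rw [if_pos hoH, if_pos hoH, ← ENNReal.ofReal_mul (Real.exp_pos _).le]
      refine ENNReal.ofReal_le_ofReal ?_
      have hZ := sum_exp_pos hH s
      have hZ' := sum_exp_pos hH s'
      have h1 : Real.exp (-s o) ≤ Real.exp Δ * Real.exp (-s' o) := by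
        rw [← Real.exp_add]
        exact Real.exp_le_exp.2 (by linarith [(abs_le.1 (h o hoH)).1])
      have h2 : ∑ h ∈ H, Real.exp (-s' h) ≤ Real.exp Δ * ∑ h ∈ H, Real.exp (-s h) := by
        rw [Finset.mul_sum]
        refine Finset.sum_le_sum fun o ho => ?_
        rw [← Real.exp_add]
        exact Real.exp_le_exp.2 (by linarith [(abs_le.1 (h o ho)).2])
      have h3 : Real.exp (2 * Δ) = Real.exp Δ * Real.exp Δ := by
        rw [← Real.exp_add]; congr 1; ring
      rw [mul_div_assoc', div_le_div_iff₀ hZ hZ', h3]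
      calc Real.exp (-s o) * ∑ h ∈ H, Real.exp (-s' h)
          ≤ (Real.exp Δ * Real.exp (-s' o)) * (Real.exp Δ * ∑ h ∈ H, Real.exp (-s h)) :=
            mul_le_mul h1 h2 hZ'.le (by positivity)
        _ = _ := by ring
    · rw [if_neg hoH]
      exact zero_le
  · rw [Set.indicator_of_notMem ho]
    exact zero_le

/-- The normalizer is at least the single term of `o`. -/
theorem expMech_bad_le {H : Finset O} (hH : H.Nonempty) {s : O → ℝ} {S : Set O} {o : O}
    (ho : o ∈ H) {σ τ : ℝ} (hσ : s o ≤ σ) (hτ : ∀ o' ∈ H, o' ∈ S → τ ≤ s o') :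
    (expMech H hH s).toOuterMeasure S ≤ ENNReal.ofReal (H.card * Real.exp (σ - τ)) := by
  classical
  have hle : ∀ o', S.indicator (expMech H hH s) o' ≤
      if o' ∈ H then ENNReal.ofReal (Real.exp (σ - τ)) else 0 := by
    intro o'
    by_cases hS : o' ∈ S
    · rw [Set.indicator_of_mem hS, expMech_apply]
      by_cases hoH : o' ∈ H
      · rw [if_pos hoH, if_pos hoH]
        refine ENNReal.ofReal_le_ofReal ?_
        rw [div_le_iff₀ (sum_exp_pos hH s)]
        calc Real.exp (-s o') ≤ Real.exp (σ - τ) * Real.exp (-s o) := by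
              rw [← Real.exp_add]
              exact Real.exp_le_exp.2 (by linarith [hτ o' hoH hS])
          _ ≤ _ := by
              refine mul_le_mul_of_nonneg_left ?_ (Real.exp_pos _).le
              exact Finset.single_le_sum (f := fun h => Real.exp (-s h))
                (fun _ _ => (Real.exp_pos _).le) ho
      · rw [if_neg hoH, if_neg hoH]
    · rw [Set.indicator_of_notMem hS]
      exact zero_le
  rw [PMF.toOuterMeasure_apply]
  refine (ENNReal.tsum_le_tsum hle).trans (le_of_eq ?_)
  rw [tsum_eq_sum (s := H) fun b hb => if_neg hb, Finset.sum_congr rfl fun h hh => if_pos hh,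
    Finset.sum_const, nsmul_eq_mul, ENNReal.ofReal_mul (by positivity), ENNReal.ofReal_natCast]

end ExpMech

/-! ### Private selection of a hypothesis by clipped pairwise comparisons -/

section Selection

variable {X : Type*} {n m : ℕ}

/-- The loss of a hypothesis on an example. -/
def loss (h : X → Bool) (z : X × Bool) : ℝ := if h z.1 ≠ z.2 then 1 else 0

theorem loss_mem (h : X → Bool) (z : X × Bool) : 0 ≤ loss h z ∧ loss h z ≤ 1 := by
  rw [loss]
  split_ifs <;> norm_num

theorem isBdd_loss (h : X → Bool) : IsBdd (loss h) := isBdd_of_mem_Icc (loss_mem h)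

theorem err_eq_ofReal_mean_loss (D : PMF (X × Bool)) (h : X → Bool) :
    err D h = ENNReal.ofReal (mean D (loss h)) := err_eq_ofReal_mean D h

/-- The sum over the users of the clipped average difference of the losses of `h` and `h'`. -/
def pairScore (B : ℝ) (h h' : X → Bool) (x : Fin n → Fin m → X × Bool) : ℝ :=
  ∑ i, clip B ((∑ j, (loss h (x i j) - loss h' (x i j))) / m)

/-- Antisymmetry lets one upper tail bound, for the best hypothesis against `h`, also bound the
score of `h` from below. -/
theorem pairScore_swap {B : ℝ} (hB : 0 ≤ B) (h h' : X → Bool) (x : Fin n → Fin m → X × Bool) :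
    pairScore B h h' x = -pairScore B h' h x := by
  rw [pairScore, pairScore, ← Finset.sum_neg_distrib]
  refine Finset.sum_congr rfl fun i _ => ?_
  rw [← clip_neg hB, ← neg_div, ← Finset.sum_neg_distrib]
  simp only [neg_sub]

theorem pairScore_sub_le {B : ℝ} (hB : 0 ≤ B) (h h' : X → Bool)
    {x x' : Fin n → Fin m → X × Bool} (hx : Neighbors x x') :
    pairScore B h h' x - pairScore B h h' x' ≤ 2 * B := by
  obtain ⟨i, hi⟩ := hx
  rw [pairScore, pairScore, ← Finset.sum_sub_distrib, Finset.sum_eq_single i]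
  · have h1 := (abs_le.1 (abs_clip_le hB ((∑ j, (loss h (x i j) - loss h' (x i j))) / m))).2
    have h2 := (abs_le.1 (abs_clip_le hB ((∑ j, (loss h (x' i j) - loss h' (x' i j))) / m))).1
    linarith
  · intro j _ hj
    rw [hi j hj, sub_self]
  · exact fun h => absurd (Finset.mem_univ i) h

theorem Neighbors.symm {Z : Type*} {x x' : Fin n → Fin m → Z} (h : Neighbors x x') :
    Neighbors x' x := by
  obtain ⟨i, hi⟩ := h
  exact ⟨i, fun j hj => (hi j hj).symm⟩

/-- The score of `h`: its worst comparison with a hypothesis of `H`. -/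
def score (B : ℝ) (H : Finset (X → Bool)) (hH : H.Nonempty) (x : Fin n → Fin m → X × Bool)
    (h : X → Bool) : ℝ := H.sup' hH fun h' => pairScore B h h' x

theorem score_sub_le {B : ℝ} (hB : 0 ≤ B) {H : Finset (X → Bool)} (hH : H.Nonempty)
    {x x' : Fin n → Fin m → X × Bool} (hx : Neighbors x x') (h : X → Bool) :
    score B H hH x h - score B H hH x' h ≤ 2 * B := by
  rw [sub_le_iff_le_add]
  refine Finset.sup'_le hH _ fun h' hh' => ?_
  have h1 := pairScore_sub_le hB h h' hx
  have h2 : pairScore B h h' x' ≤ score B H hH x' h :=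
    Finset.le_sup' (fun h' => pairScore B h h' x') hh'
  linarith

open Classical in
/-- The learner: draw a class from `P`, then select from it by the exponential mechanism. -/
def learner (P : PMF (Finset (X → Bool))) (B ε : ℝ) : Algorithm n m (X × Bool) (X → Bool) :=
  fun x => P.bind fun H =>
    if hH : H.Nonempty then expMech H hH fun h => ε / (4 * B) * score B H hH x h
    else PMF.pure fun _ => false

/-- The class is drawn independently of the data. One user moves the scaled losses by at most `(ε /
(4 * B)) * (2 * B) = ε / 2`, which the exponential mechanism doubles. -/
theorem isUserLevelDP_learner (P : PMF (Finset (X → Bool))) {B ε : ℝ} (hB : 0 < B) (hε : 0 < ε) :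
    IsUserLevelDP (learner (n := n) (m := m) P B ε) ε 0 := by
  intro x x' hx S
  rw [ENNReal.ofReal_zero, add_zero, learner, learner, toOuterMeasure_bind_eq_expect,
    toOuterMeasure_bind_eq_expect, ← expect_const_mul]
  refine expect_mono fun H => ?_
  by_cases hH : H.Nonempty
  · rw [dif_pos hH, dif_pos hH]
    have h := expMech_le hH (s := fun h => ε / (4 * B) * score B H hH x h)
      (s' := fun h => ε / (4 * B) * score B H hH x' h) (Δ := ε / 2) (fun o _ => ?_) S
    · rwa [mul_div_cancel₀ ε two_ne_zero] at h
    · rw [← mul_sub, abs_mul, abs_of_pos (by positivity)]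
      have h1 : |score B H hH x o - score B H hH x' o| ≤ 2 * B :=
        abs_sub_le_iff.2 ⟨score_sub_le hB.le hH hx o, score_sub_le hB.le hH hx.symm o⟩
      calc ε / (4 * B) * |score B H hH x o - score B H hH x' o| ≤ ε / (4 * B) * (2 * B) :=
            mul_le_mul_of_nonneg_left h1 (by positivity)
        _ = ε / 2 := by field_simp; norm_num
  · rw [dif_neg hH, dif_neg hH]
    refine le_mul_of_one_le_left zero_le ?_
    rw [ENNReal.one_le_ofReal, Real.one_le_exp_iff]
    exact hε.le

theorem pairScore_ge_le (D : PMF (X × Bool)) (h h' : X → Bool) {a μ B : ℝ} (ha : 0 < a)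
    (hμ : mean D (loss h) - mean D (loss h') ≤ μ) (hμa : -a ≤ μ) (hm : 1 ≤ m) (haB : a ≤ B)
    (hB : a + 2 * (1 + Real.log (16 / a)) / √m ≤ B) :
    (iid n (iid m D)).toOuterMeasure {x | n * (μ + a / 4) ≤ pairScore B h h' x} ≤
      ENNReal.ofReal (Real.exp (-(n * (a ^ 2 / (256 * B ^ 2))))) := by
  have hB0 : 0 ≤ B := ha.le.trans haB
  set g : X × Bool → ℝ := fun z => loss h z - loss h' z with hg
  have key : mean (iid m D) (fun y => clip B ((∑ j, g (y j)) / m)) ≤ μ + a / 8 := by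
    refine mean_clip_average_le (fun z => ?_) ha ?_ hμa hm hB hB0
    · have h1 := loss_mem h z
      have h2 := loss_mem h' z
      exact abs_le.2 ⟨by linarith, by linarith⟩
    · rwa [hg, mean_sub D (isBdd_loss h) (isBdd_loss h')]
  exact iid_sum_ge_le (q := iid m D) (V := fun y => clip B ((∑ j, g (y j)) / m)) ha haB
    (fun y => abs_clip_le hB0 _) key n

/-- Utility of the selection from a fixed class. -/
theorem select_bad_le (D : PMF (X × Bool)) {H : Finset (X → Bool)} (hH : H.Nonempty)
    {h₀ : X → Bool} (hh₀ : h₀ ∈ H) {G : Set (X → Bool)} {a ε B : ℝ} (ha : 0 < a) (hε : 0 < ε)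
    (hG : ∀ h, h ∉ G → mean D (loss h₀) + a ≤ mean D (loss h))
    (hm : 1 ≤ m) (haB : a ≤ B) (hB : a + 2 * (1 + Real.log (16 / a)) / √m ≤ B) :
    (expect (iid n (iid m D)) fun x =>
        (expMech H hH fun h => ε / (4 * B) * score B H hH x h).toOuterMeasure Gᶜ) ≤
      ENNReal.ofReal (H.card * Real.exp (-(n * (a ^ 2 / (256 * B ^ 2)))) +
        H.card * Real.exp (-(n * (ε * a / (8 * B))))) := by
  classical
  have hB0 : 0 < B := ha.trans_le haB
  obtain ⟨o, ho, hmin⟩ := Finset.exists_min_image H (fun h => mean D (loss h)) hH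
  -- Comparisons of the best `o` need only a one-sided bound: mean at most `-a` against hypotheses
  -- worse by `a`, at most 0 against the others.
  set μ : (X → Bool) → ℝ := fun h =>
    if mean D (loss o) + a ≤ mean D (loss h) then -a else 0 with hμ
  set ev : (X → Bool) → Set (Fin n → Fin m → X × Bool) := fun h =>
    {x | n * (μ h + a / 4) ≤ pairScore B o h x} with hev
  have hprob : ∀ h ∈ H, (iid n (iid m D)).toOuterMeasure (ev h) ≤
      ENNReal.ofReal (Real.exp (-(n * (a ^ 2 / (256 * B ^ 2))))) := fun h hh => by
    refine pairScore_ge_le D o h ha ?_ ?_ hm haB hB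
    · simp only [hμ]
      split_ifs with h1
      · linarith
      · linarith [hmin h hh]
    · simp only [hμ]
      split_ifs <;> linarith
  have hpt : ∀ x, (expMech H hH fun h => ε / (4 * B) * score B H hH x h).toOuterMeasure Gᶜ ≤
      (∑ h ∈ H, (ev h).indicator 1 x) +
        ENNReal.ofReal (H.card * Real.exp (-(n * (ε * a / (8 * B))))) := fun x => by
    by_cases hx : ∃ h ∈ H, x ∈ ev h
    · obtain ⟨h, hh, hxh⟩ := hx
      refine (toOuterMeasure_le_one _ _).trans (le_trans ?_ le_self_add)
      calc (1 : ℝ≥0∞) = (ev h).indicator 1 x := by rw [Set.indicator_of_mem hxh, Pi.one_apply]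
        _ ≤ _ := Finset.single_le_sum (f := fun h => (ev h).indicator (1 : (Fin n → Fin m → X × Bool) → ℝ≥0∞) x)
            (fun _ _ => zero_le) hh
    · push Not at hx
      have hlt : ∀ h ∈ H, pairScore B o h x < n * (μ h + a / 4) := fun h hh => not_le.1 (hx h hh)
      refine le_trans ?_ le_add_self
      have hscale : 0 ≤ ε / (4 * B) := by positivity
      -- If no deviation occurs, `o` scores at most `n * a / 4`, while its comparison with a bad `h`
      -- forces `h` to score at least `3 * n * a / 4`.
      refine (expMech_bad_le hH ho (σ := ε / (4 * B) * (n * (a / 4)))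
        (τ := ε / (4 * B) * (n * (3 * a / 4))) ?_ ?_).trans (le_of_eq ?_)
      · refine mul_le_mul_of_nonneg_left ?_ hscale
        refine Finset.sup'_le hH _ fun h hh => (hlt h hh).le.trans ?_
        refine mul_le_mul_of_nonneg_left ?_ (Nat.cast_nonneg n)
        simp only [hμ]
        split_ifs <;> linarith
      · intro h hh hbad
        refine mul_le_mul_of_nonneg_left ?_ hscale
        have h1 := hlt h hh
        have h2 : mean D (loss o) + a ≤ mean D (loss h) := by
          linarith [hG h hbad, hmin h₀ hh₀]
        simp only [hμ, if_pos h2] at h1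
        have h3 : pairScore B h o x ≤ score B H hH x h :=
          Finset.le_sup' (fun h' => pairScore B h h' x) ho
        rw [pairScore_swap hB0.le] at h3
        linarith
      · congr 3
        field_simp
        ring
  refine (expect_mono hpt).trans ?_
  rw [expect_add, expect_sum, expect_const, ENNReal.ofReal_add (by positivity) (by positivity)]
  gcongr
  calc ∑ h ∈ H, expect (iid n (iid m D)) ((ev h).indicator 1)
      ≤ ∑ _h ∈ H, ENNReal.ofReal (Real.exp (-(n * (a ^ 2 / (256 * B ^ 2))))) :=
        Finset.sum_le_sum fun h hh => by
          rw [← toOuterMeasure_eq_expect]; exact hprob h hh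
    _ = _ := by
        rw [Finset.sum_const, nsmul_eq_mul, ENNReal.ofReal_mul (by positivity),
          ENNReal.ofReal_natCast]

end Selection

/-! ### The upper bound -/

section UpperBound

variable {X : Type*} {C : Set (X → Bool)}

/-- Classes of size at most 1 cannot fit both concepts at a point where they differ, yet each must
be fitted with probability 3/4. This bound absorbs additive constants into multiples of `d`. -/
theorem log_two_le_prDim {c₁ c₂ : X → Bool} (h₁ : c₁ ∈ C) (h₂ : c₂ ∈ C) (hne : c₁ ≠ c₂) :
    ENNReal.ofReal (Real.log 2) ≤ prDim C := by
  obtain ⟨x, hx⟩ := Function.ne_iff.1 hne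
  refine le_iInf₂ fun P hP => ?_
  by_contra hcon
  have hcard : ∀ H ∈ P.support, H.card ≤ 1 := by
    intro H hH
    by_contra h1
    refine hcon (le_iSup₂_of_le H hH (ENNReal.ofReal_le_ofReal ?_))
    exact Real.log_le_log (by norm_num) (by exact_mod_cast not_le.1 h1)
  set G : (X → Bool) → Set (Finset (X → Bool)) := fun c =>
    {H | ∃ h ∈ H, (PMF.pure x).toOuterMeasure {x | c x ≠ h x} ≤ ENNReal.ofReal (1 / 4)} with hG
  have hGx : ∀ c H, H ∈ G c → ∃ h ∈ H, c x = h x := by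
    rintro c H ⟨h, hh, hle⟩
    refine ⟨h, hh, ?_⟩
    by_contra hcx
    rw [PMF.toOuterMeasure_pure_apply, if_pos (by simpa using hcx), ENNReal.one_le_ofReal] at hle
    norm_num at hle
  have hsum : P.toOuterMeasure (G c₁) + P.toOuterMeasure (G c₂) ≤ 1 := by
    rw [toOuterMeasure_eq_expect, toOuterMeasure_eq_expect, ← expect_add, ← expect_const P 1]
    refine expect_mono_support fun H hH => ?_
    by_cases hH1 : H ∈ G c₁
    · have hH2 : H ∉ G c₂ := fun hH2 => by
        obtain ⟨h, hh, he⟩ := hGx c₁ H hH1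
        obtain ⟨h', hh', he'⟩ := hGx c₂ H hH2
        rw [Finset.card_le_one.1 (hcard H hH) h hh h' hh'] at he
        exact hx (he.trans he'.symm)
      simp [hH1, hH2]
    · rw [Set.indicator_of_notMem hH1, zero_add]
      exact Set.indicator_le_self' (fun _ _ => zero_le) _
  have h3 := (add_le_add (hP c₁ h₁ (PMF.pure x)) (hP c₂ h₂ (PMF.pure x))).trans hsum
  rw [← ENNReal.ofReal_add (by norm_num) (by norm_num), ENNReal.ofReal_le_one] at h3
  norm_num at h3

theorem err_le_add (D : PMF (X × Bool)) (c h : X → Bool) :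
    err D h ≤ err D c + (D.map Prod.fst).toOuterMeasure {x | c x ≠ h x} := by
  rw [err, err, PMF.toOuterMeasure_map_apply]
  refine (MeasureTheory.measure_mono fun z hz => ?_).trans (MeasureTheory.measure_union_le _ _)
  by_cases hc : c z.1 = z.2
  · right
    change c z.1 ≠ h z.1
    rw [hc]
    exact Ne.symm hz
  · exact Or.inl hc

/-- The error budget is `α / 4` for a near-optimal concept, as the infimum may not be attained, `α /
4` for its representation and `α / 2` for selection. The failure budget is 1/12 each for
representation, concentration and the mechanism. -/
theorem isUseful_learner {P : PMF (Finset (X → Bool))} {n m : ℕ} {α ε B N : ℝ}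
    (hC : C.Nonempty) (hα : 0 < α) (hε : 0 < ε) (hm : 1 ≤ m)
    (hP : ∀ H ∈ P.support, H.Nonempty ∧ (H.card : ℝ) ≤ N)
    (hrep : ∀ c ∈ C, ∀ D : PMF X, P.toOuterMeasure
      {H | ∃ h ∈ H, D.toOuterMeasure {x | c x ≠ h x} ≤ ENNReal.ofReal (α / 4)}ᶜ ≤
        ENNReal.ofReal (1 / 12))
    (haB : α / 2 ≤ B) (hB : α / 2 + 2 * (1 + Real.log (16 / (α / 2))) / √m ≤ B)
    (h1 : N * Real.exp (-(n * ((α / 2) ^ 2 / (256 * B ^ 2)))) ≤ 1 / 12)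
    (h2 : N * Real.exp (-(n * (ε * (α / 2) / (8 * B)))) ≤ 1 / 12) :
    IsUseful (learner (n := n) (m := m) P B ε) (agnostic C α) (2 / 3) := by
  intro D
  set G := agnostic C α D with hG
  have hinf : (⨅ c ∈ C, err D c) ≠ ⊤ := by
    obtain ⟨c, hc⟩ := hC
    exact ((iInf₂_le c hc).trans_lt ((toOuterMeasure_le_one _ _).trans_lt ENNReal.one_lt_top)).ne
  have hlt : (⨅ c ∈ C, err D c) < (⨅ c ∈ C, err D c) + ENNReal.ofReal (α / 4) := by
    refine ENNReal.lt_add_right hinf ?_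
    rw [Ne, ENNReal.ofReal_eq_zero]
    linarith
  simp only [iInf_lt_iff] at hlt
  obtain ⟨c, hc, hcerr⟩ := hlt
  set R : Set (Finset (X → Bool)) :=
    {H | ∃ h ∈ H, (D.map Prod.fst).toOuterMeasure {x | c x ≠ h x} ≤ ENNReal.ofReal (α / 4)}
    with hR
  have hbad : ((iid n (iid m D)).bind (learner P B ε)).toOuterMeasure Gᶜ ≤
      ENNReal.ofReal (1 / 3) := by
    rw [toOuterMeasure_bind_eq_expect]
    simp only [learner, toOuterMeasure_bind_eq_expect]
    rw [expect_comm]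
    calc _ ≤ expect P fun H => Rᶜ.indicator 1 H + ENNReal.ofReal (1 / 6) := by
          refine expect_mono_support fun H hH => ?_
          obtain ⟨hne, hcard⟩ := hP H hH
          by_cases hHR : H ∈ R
          · obtain ⟨h₀, hh₀, hle⟩ := hHR
            refine le_trans ?_ le_add_self
            simp only [dif_pos hne]
            refine (select_bad_le D hne hh₀ (a := α / 2) (by positivity) hε (fun h hh => ?_) hm haB
              hB).trans (ENNReal.ofReal_le_ofReal ?_)
            · by_contra hcon
              refine hh ?_
              change err D h ≤ _
              have e0 : err D h₀ ≤ (⨅ c ∈ C, err D c) + ENNReal.ofReal (α / 2) := by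
                calc err D h₀ ≤ err D c + ENNReal.ofReal (α / 4) :=
                      (err_le_add D c h₀).trans (add_le_add_right hle _)
                  _ ≤ ((⨅ c ∈ C, err D c) + ENNReal.ofReal (α / 4)) + ENNReal.ofReal (α / 4) :=
                      add_le_add_left hcerr.le _
                  _ = _ := by
                      rw [add_assoc, ← ENNReal.ofReal_add (by positivity) (by positivity)]
                      congr 2
                      ring
              calc err D h ≤ err D h₀ + ENNReal.ofReal (α / 2) := by
                    rw [err_eq_ofReal_mean_loss, err_eq_ofReal_mean_loss, ← ENNReal.ofReal_add
                      (mean_nonneg D fun z => (loss_mem h₀ z).1) (by positivity)]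
                    exact ENNReal.ofReal_le_ofReal (not_le.1 hcon).le
                _ ≤ ((⨅ c ∈ C, err D c) + ENNReal.ofReal (α / 2)) + ENNReal.ofReal (α / 2) :=
                    add_le_add_left e0 _
                _ = _ := by
                    rw [add_assoc, ← ENNReal.ofReal_add (by positivity) (by positivity)]
                    congr 2
                    ring
            · have k1 := mul_le_mul_of_nonneg_right hcard
                (Real.exp_pos (-(n * ((α / 2) ^ 2 / (256 * B ^ 2))))).le
              have k2 := mul_le_mul_of_nonneg_right hcard
                (Real.exp_pos (-(n * (ε * (α / 2) / (8 * B))))).le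
              linarith
          · rw [Set.indicator_of_mem (by exact hHR), Pi.one_apply]
            refine le_trans ?_ le_self_add
            rw [← expect_const (iid n (iid m D)) 1]
            exact expect_mono fun x => toOuterMeasure_le_one _ _
      _ ≤ ENNReal.ofReal (1 / 12) + ENNReal.ofReal (1 / 6) := by
          rw [expect_add, expect_const, ← toOuterMeasure_eq_expect]
          gcongr
          exact hrep c hc _
      _ ≤ _ := by
          rw [← ENNReal.ofReal_add (by norm_num) (by norm_num)]
          exact ENNReal.ofReal_le_ofReal (by norm_num)
  have hsum := toOuterMeasure_add_compl ((iid n (iid m D)).bind (learner P B ε)) G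
  have hle : ENNReal.ofReal (2 / 3) + ENNReal.ofReal (1 / 3) ≤
      ((iid n (iid m D)).bind (learner P B ε)).toOuterMeasure G + ENNReal.ofReal (1 / 3) := by
    rw [← ENNReal.ofReal_add (by norm_num) (by norm_num)]
    calc ENNReal.ofReal (2 / 3 + 1 / 3) = 1 := by norm_num
      _ = _ := hsum.symm
      _ ≤ _ := add_le_add_right hbad _
  exact (ENNReal.add_le_add_iff_right ENNReal.ofReal_ne_top).1 hle

/-- Amplification of a probabilistic representation. -/
theorem exists_representation {d : ℝ} (hd : Real.log 2 ≤ d) (hdim : prDim C = ENNReal.ofReal d)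
    {α : ℝ} (hα : 0 < α) (T : ℕ) (hT : 128 * Real.log (48 / α) ≤ T) :
    ∃ P : PMF (Finset (X → Bool)),
      (∀ H ∈ P.support, H.Nonempty ∧ (H.card : ℝ) ≤ Real.exp (4 * d * T)) ∧
      ∀ c ∈ C, ∀ D : PMF X, P.toOuterMeasure
        {H | ∃ h ∈ H, D.toOuterMeasure {x | c x ≠ h x} ≤ ENNReal.ofReal (α / 4)}ᶜ ≤
          ENNReal.ofReal (1 / 12) := by
  have hlog2 : 0 < Real.log 2 := Real.log_pos (by norm_num)
  have hd0 : 0 < d := hlog2.trans_le hd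
  -- The slack `2 * d` avoids assuming that the infimum is attained.
  have hlt : prDim C < ENNReal.ofReal (2 * d) := by
    rw [hdim, ENNReal.ofReal_lt_ofReal_iff (by positivity)]
    linarith
  simp only [prDim, prDimAt, iInf_lt_iff] at hlt
  obtain ⟨P, hP, hsize⟩ := hlt
  set M := ⌊Real.exp (2 * d)⌋₊ + 1 with hM
  have hcard : ∀ H ∈ P.support, H.card + 1 ≤ M := by
    intro H hH
    refine Nat.succ_le_succ (Nat.le_floor ?_)
    have h1 : ENNReal.ofReal (Real.log (H.card : ℝ)) ≤ ENNReal.ofReal (2 * d) :=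
      (le_iSup₂ (f := fun (H : Finset (X → Bool)) (_ : H ∈ P.support) =>
        ENNReal.ofReal (Real.log (H.card : ℝ))) H hH).trans hsize.le
    rw [ENNReal.ofReal_le_ofReal_iff (by positivity)] at h1
    rcases Nat.eq_zero_or_pos H.card with h0 | h0
    · rw [h0]
      simpa using (Real.exp_pos _).le
    · exact (Real.log_le_iff_le_exp (by exact_mod_cast h0)).1 h1
  have hMle : (M : ℝ) ≤ Real.exp (4 * d) := by
    have h1 : (M : ℝ) ≤ Real.exp (2 * d) + 1 := by
      rw [hM]
      push_cast
      linarith [Nat.floor_le (Real.exp_pos (2 * d)).le]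
    have h2 : 2 ≤ Real.exp (2 * d) := by
      rw [← Real.log_le_iff_le_exp (by norm_num)]
      linarith
    have h3 : Real.exp (4 * d) = Real.exp (2 * d) * Real.exp (2 * d) := by
      rw [← Real.exp_add]; congr 1; ring
    rw [h3]
    nlinarith
  refine ⟨boosted P T, fun H hH => ?_, fun c hc D => ?_⟩
  · obtain ⟨hne, hle⟩ := nonempty_and_card_le_of_mem_support_boosted hcard hH
    refine ⟨hne, ?_⟩
    calc (H.card : ℝ) ≤ (M : ℝ) ^ T := by exact_mod_cast hle
      _ ≤ Real.exp (4 * d) ^ T := pow_le_pow_left₀ (Nat.cast_nonneg _) hMle T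
      _ = _ := by
        rw [← Real.exp_nat_mul]; congr 1; ring
  · refine (boosted_compl_le hP hc D (by positivity : 0 < α / 4) T).trans
      (ENNReal.ofReal_le_ofReal ?_)
    -- `α / 48` is the accuracy `α / 4` times the failure probability 1/12.
    have h1 : ((127 : ℝ) / 128) ^ T ≤ α / 48 := by
      calc ((127 : ℝ) / 128) ^ T ≤ Real.exp (-(1 / 128)) ^ T := by
            refine pow_le_pow_left₀ (by norm_num) ?_ T
            linarith [Real.add_one_le_exp (-(1 / 128 : ℝ))]
        _ = Real.exp (T * -(1 / 128)) := (Real.exp_nat_mul _ _).symm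
        _ ≤ Real.exp (-Real.log (48 / α)) := Real.exp_le_exp.2 (by linarith)
        _ = α / 48 := by rw [Real.exp_neg, Real.exp_log (by positivity), inv_div]
    rw [div_le_iff₀ (by positivity)]
    linarith

theorem userComplexity_le_of {Z O : Type*} {Ψ : PMF Z → Set O} {n m : ℕ} {ε δ γ : ℝ}
    {A : Algorithm n m Z O} (hA : IsUserLevelDP A ε δ) (hU : IsUseful A Ψ γ) :
    userComplexity Ψ m ε δ γ ≤ n := iInf₂_le n ⟨A, hA, hU⟩

theorem userComplexity_singleton (c : X → Bool) (m : ℕ) (α ε : ℝ) :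
    userComplexity (agnostic {c} α) m ε 0 (2 / 3) = 0 := by
  have h := userComplexity_le_of (n := 0) (m := m) (ε := ε) (δ := 0) (γ := 2 / 3)
    (Ψ := agnostic {c} α) (A := fun _ => PMF.pure c) (fun x x' hx => hx.choose.elim0) (fun D => by
      have hc : c ∈ agnostic {c} α D := by
        change err D c ≤ _
        rw [iInf_singleton]
        exact le_self_add
      rw [PMF.bind_const, PMF.toOuterMeasure_pure_apply, if_pos hc, ENNReal.ofReal_le_one]
      norm_num)
  simpa using h

theorem one_le_log_three_add {t : ℝ} (ht : 0 ≤ t) : 1 ≤ Real.log (3 + t) := by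
  rw [Real.le_log_iff_exp_le (by linarith)]
  linarith [Real.exp_one_lt_three]

theorem one_le_logFactor (k : ℕ) (t : ℝ≥0∞) : 1 ≤ logFactor k t := by
  rw [logFactor, ENNReal.one_le_ofReal]
  exact one_le_pow₀ (one_le_log_three_add ENNReal.toReal_nonneg)

/-- For `ρ = B / (α / 2)` the left side is the number of users per unit of log-size: privacy plus
concentration. Squaring `1 + 22 * v` gives `2 + 968 * v ^ 2`, and `256 * 968 = 247808`. -/
theorem quotient_le {ρ Λ α ε s m v : ℝ} (hα : 0 < α) (hε : 0 < ε) (hε1 : ε ≤ 1) (hm0 : 0 < m)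
    (hs0 : 0 < s) (hss : s ^ 2 = m) (hΛ1 : 1 ≤ Λ) (hv : v = Λ / (α * s)) (hρ0 : 0 < ρ)
    (hρv : ρ ≤ 1 + 22 * v) :
    8 * ρ / ε + 256 * ρ ^ 2 ≤
      247808 * Λ ^ 2 * (1 / ε + 1 / (α * ε * s) + 1 / (α ^ 2 * m)) := by
  have hsq : ρ ^ 2 ≤ 2 + 968 * v ^ 2 := by
    have := pow_le_pow_left₀ hρ0.le hρv 2
    nlinarith [sq_nonneg (1 - 22 * v)]
  have e1 : v ^ 2 = Λ ^ 2 * (1 / (α ^ 2 * m)) := by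
    rw [hv, ← hss]; field_simp
  have e2 : v / ε = Λ * (1 / (α * ε * s)) := by
    rw [hv]; field_simp
  have e3 : 8 * ρ / ε ≤ 8 * (1 / ε) + 176 * (v / ε) := by
    have : 8 * (1 / ε) + 176 * (v / ε) = (8 * (1 + 22 * v)) / ε := by ring
    rw [this]
    exact div_le_div_of_nonneg_right (by linarith) hε.le
  have e4 : 1 ≤ 1 / ε := by rw [le_div_iff₀ hε]; linarith
  have e5 : 1 ≤ Λ ^ 2 := one_le_pow₀ hΛ1
  have e6 : Λ ≤ Λ ^ 2 := le_self_pow₀ hΛ1 two_ne_zero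
  have p1 : 0 < 1 / (α * ε * s) := by positivity
  have p2 : 0 < 1 / (α ^ 2 * m) := by positivity
  have k1 := mul_le_mul_of_nonneg_right e6 p1.le
  have k2 := mul_le_mul_of_nonneg_right e5 (by linarith : 0 ≤ 1 / ε)
  have k3 : 0 ≤ Λ ^ 2 * (1 / (α * ε * s)) := by positivity
  rw [e2] at e3
  rw [e1] at hsq
  have k4 : 0 ≤ Λ ^ 2 * (1 / ε) := by positivity
  have : 247808 * Λ ^ 2 * (1 / ε + 1 / (α * ε * s) + 1 / (α ^ 2 * m)) =
    247808 * (Λ ^ 2 * (1 / ε)) + 247808 * (Λ ^ 2 * (1 / (α * ε * s))) +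
      247808 * (Λ ^ 2 * (1 / (α ^ 2 * m))) := by ring
  rw [this]
  linarith

/-- The number of users that suffices, in real numbers. -/
theorem exists_user_bound {d α ε : ℝ} {m : ℕ} (hd : Real.log 2 ≤ d) (hα : 0 < α)
    (hα1 : α ≤ 1 / 40) (hε : 0 < ε) (hε1 : ε ≤ 1) (hm : 1 ≤ m) {f : ℝ}
    (hf : f = d / ε + d / (α * ε * √m) + d / (α ^ 2 * m)) :
    ∃ (T n : ℕ) (B : ℝ), 128 * Real.log (48 / α) ≤ T ∧ α / 2 ≤ B ∧
      α / 2 + 2 * (1 + Real.log (16 / (α / 2))) / √m ≤ B ∧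
      Real.exp (4 * d * T) * Real.exp (-(n * ((α / 2) ^ 2 / (256 * B ^ 2)))) ≤ 1 / 12 ∧
      Real.exp (4 * d * T) * Real.exp (-(n * (ε * (α / 2) / (8 * B)))) ≤ 1 / 12 ∧
      (n : ℝ) ≤ 10 ^ 9 * Real.log (3 + (f + 1 / α)) ^ 3 * f := by
  have hm0 : (0 : ℝ) < m := by exact_mod_cast hm
  set s := √(m : ℝ) with hs
  have hs0 : 0 < s := Real.sqrt_pos.2 hm0
  have hss : s ^ 2 = m := Real.sq_sqrt hm0.le
  have hl2a : 0.6931471803 < Real.log 2 := Real.log_two_gt_d9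
  have hl2b : Real.log 2 < 0.6931471808 := Real.log_two_lt_d9
  have hd0 : 0 < d := by linarith
  have hf0 : 0 ≤ f := by rw [hf]; positivity
  set Λ := Real.log (3 + (f + 1 / α)) with hΛ
  have hΛ1 : 1 ≤ Λ := one_le_log_three_add (by positivity)
  have hαΛ : Real.log (1 / α) ≤ Λ :=
    Real.log_le_log (by positivity) (by linarith)
  have hα0 : 0 ≤ Real.log (1 / α) := Real.log_nonneg (by rw [le_div_iff₀ hα]; linarith)
  set l := 1 + Real.log (16 / (α / 2)) with hl
  have hlog32 : Real.log (16 / (α / 2)) = 5 * Real.log 2 + Real.log (1 / α) := by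
    have : (16 : ℝ) / (α / 2) = 2 ^ 5 * (1 / α) := by field_simp; norm_num
    rw [this, Real.log_mul (by norm_num) (by positivity), Real.log_pow]
    norm_num
  have hl0 : 0 ≤ l := by rw [hl, hlog32]; linarith
  have hlΛ : l ≤ 5.5 * Λ := by rw [hl, hlog32]; linarith
  have hlog48 : Real.log (48 / α) ≤ 6 * Real.log 2 + Real.log (1 / α) := by
    have h1 : (48 : ℝ) / α ≤ 2 ^ 6 * (1 / α) := by
      rw [mul_one_div]
      exact div_le_div_of_nonneg_right (by norm_num) hα.le
    have h2 := Real.log_le_log (by positivity) h1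
    rw [Real.log_mul (by norm_num) (by positivity), Real.log_pow] at h2
    push_cast at h2
    exact h2
  set T := ⌈128 * Real.log (48 / α)⌉₊ with hT
  have hlog48' : 0 ≤ Real.log (48 / α) := Real.log_nonneg (by rw [le_div_iff₀ hα]; linarith)
  have hTΛ : (T : ℝ) ≤ 667 * Λ := by
    have := (Nat.ceil_lt_add_one (a := 128 * Real.log (48 / α)) (by positivity)).le
    rw [← hT] at this
    linarith
  set a := α / 2 with ha
  have ha0 : 0 < a := by positivity
  set B := a + 2 * l / s with hB
  have haB : a ≤ B := by
    have : 0 ≤ 2 * l / s := by positivity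
    linarith
  have hB0 : 0 < B := by linarith
  -- The log-size bound plus `log 16`, enough for a failure probability of 1/12.
  set L := 4 * d * T + 4 * Real.log 2 with hL
  have hL0 : 0 ≤ L := by
    have : 0 ≤ 4 * d * T := by positivity
    rw [hL]; linarith
  have hLΛ : L ≤ 2672 * (d * Λ) := by
    have h1 : d * T ≤ d * (667 * Λ) := mul_le_mul_of_nonneg_left hTΛ hd0.le
    have h2 : d ≤ d * Λ := le_mul_of_one_le_right hd0.le hΛ1
    rw [hL]; linarith
  set ρ := B / a with hρ
  have hρ0 : 0 < ρ := by positivity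
  set v := Λ / (α * s) with hv
  have hv0 : 0 < v := by positivity
  have hρv : ρ ≤ 1 + 22 * v := by
    have h1 : ρ = 1 + 4 * l / (α * s) := by
      rw [hρ, hB, ha]; field_simp; ring
    have h2 : 4 * l / (α * s) ≤ 22 * v := by
      rw [hv, mul_div_assoc']
      exact div_le_div_of_nonneg_right (by linarith) (by positivity)
    linarith
  set Q := 8 * ρ / ε + 256 * ρ ^ 2 with hQ
  have hQ0 : 0 ≤ Q := by positivity
  set n := ⌈L * Q⌉₊ with hn
  have hnL : L * Q ≤ n := Nat.le_ceil _
  have hexp : ∀ t : ℝ, L ≤ n * t → Real.exp (4 * d * T) * Real.exp (-(n * t)) ≤ 1 / 12 := by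
    intro t ht
    rw [← Real.exp_add]
    calc Real.exp (4 * d * T + -(n * t)) ≤ Real.exp (-(4 * Real.log 2)) :=
          Real.exp_le_exp.2 (by rw [hL] at ht; linarith)
      _ ≤ 1 / 12 := by
        rw [Real.exp_neg]
        have : Real.exp (4 * Real.log 2) = 16 := by
          have := Real.exp_nat_mul (Real.log 2) 4
          rw [Real.exp_log (by norm_num)] at this
          norm_num at this
          exact this
        rw [this]; norm_num
  refine ⟨T, n, B, Nat.le_ceil _, haB, le_rfl, hexp _ ?_, hexp _ ?_, ?_⟩
  · have h1 : a ^ 2 / (256 * B ^ 2) = 1 / (256 * ρ ^ 2) := by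
      rw [hρ]; field_simp
    rw [h1, mul_one_div, le_div_iff₀ (by positivity)]
    refine le_trans (mul_le_mul_of_nonneg_left ?_ hL0) hnL
    rw [hQ]
    have : 0 ≤ 8 * ρ / ε := by positivity
    linarith
  · have h1 : ε * a / (8 * B) = 1 / (8 * ρ / ε) := by
      rw [hρ]; field_simp
    rw [h1, mul_one_div, le_div_iff₀ (by positivity)]
    refine le_trans (mul_le_mul_of_nonneg_left ?_ hL0) hnL
    rw [hQ]
    have : 0 ≤ 256 * ρ ^ 2 := by positivity
    linarith
  · have hQle : Q ≤ 247808 * Λ ^ 2 * (1 / ε + 1 / (α * ε * s) + 1 / (α ^ 2 * m)) :=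
      quotient_le hα hε hε1 hm0 hs0 hss hΛ1 hv hρ0 hρv
    have hprod : L * Q ≤ 2672 * 247808 * (Λ ^ 3 * f) := by
      calc L * Q ≤ (2672 * (d * Λ)) *
            (247808 * Λ ^ 2 * (1 / ε + 1 / (α * ε * s) + 1 / (α ^ 2 * m))) :=
            mul_le_mul hLΛ hQle hQ0 (by positivity)
        _ = _ := by rw [hf]; ring
    -- Absorbs the rounding up in `n`; it uses `f ≥ d ≥ log 2`.
    have hone : 1 ≤ 2 * (Λ ^ 3 * f) := by
      have h1 : 1 ≤ Λ ^ 3 := one_le_pow₀ hΛ1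
      have h2 : d ≤ f := by
        have h3 : d ≤ d / ε := le_div_self hd0.le hε hε1
        have h4 : 0 ≤ d / (α * ε * s) + d / (α ^ 2 * m) := by positivity
        rw [hf]; linarith
      have h5 : f ≤ Λ ^ 3 * f := le_mul_of_one_le_left hf0 h1
      linarith
    have hceil := (Nat.ceil_lt_add_one (a := L * Q) (by positivity)).le
    rw [← hn] at hceil
    have : 0 ≤ Λ ^ 3 * f := by positivity
    linarith

theorem rate_ofReal {d α ε : ℝ} (hd : 0 ≤ d) (hα : 0 < α) (hε : 0 < ε) {m : ℕ} (hm : 1 ≤ m) :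
    rate (ENNReal.ofReal d) (ENNReal.ofReal d) α ε m =
      ENNReal.ofReal (d / ε + d / (α * ε * √m) + d / (α ^ 2 * m)) := by
  have hm0 : (0 : ℝ) < m := by exact_mod_cast hm
  rw [rate, ← ENNReal.ofReal_div_of_pos hε, ← ENNReal.ofReal_div_of_pos (by positivity),
    ← ENNReal.ofReal_div_of_pos (by positivity), ← ENNReal.ofReal_add (by positivity)
    (by positivity), ← ENNReal.ofReal_add (by positivity) (by positivity)]

theorem userComplexity_le_rate (hC : C.Nonempty) {α ε : ℝ} (hα : 0 < α) (hα1 : α ≤ 1 / 40)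
    (hε : 0 < ε) (hε1 : ε ≤ 1) {m : ℕ} (hm : 1 ≤ m) :
    ((userComplexity (agnostic C α) m ε 0 (2 / 3) : ℕ∞) : ℝ≥0∞) ≤
      ENNReal.ofReal (10 ^ 9) *
        logFactor 3 (rate (prDim C) (prDim C) α ε m + ENNReal.ofReal (1 / α)) *
        rate (prDim C) (prDim C) α ε m := by
  obtain ⟨c₁, h₁⟩ := id hC
  by_cases hsub : ∃ c₂ ∈ C, c₁ ≠ c₂
  · obtain ⟨c₂, h₂, hne⟩ := hsub
    by_cases htop : prDim C = ⊤
    · have hr : rate (prDim C) (prDim C) α ε m = ⊤ := by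
        rw [rate, htop, ENNReal.top_div_of_ne_top ENNReal.ofReal_ne_top]
        simp
      rw [hr, ENNReal.mul_top]
      · exact le_top
      · refine mul_ne_zero (by simp) ?_
        exact (zero_lt_one.trans_le (one_le_logFactor _ _)).ne'
    · set d := (prDim C).toReal with hd
      have hdim : prDim C = ENNReal.ofReal d := (ENNReal.ofReal_toReal htop).symm
      have hd2 : Real.log 2 ≤ d := by
        have := log_two_le_prDim h₁ h₂ hne
        rwa [hdim, ENNReal.ofReal_le_ofReal_iff ENNReal.toReal_nonneg] at this
      obtain ⟨T, n, B, hT, haB, hB, hx1, hx2, hn⟩ :=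
        exists_user_bound hd2 hα hα1 hε hε1 hm rfl
      obtain ⟨P, hP, hrep⟩ := exists_representation hd2 hdim hα T hT
      have hU := isUseful_learner (n := n) hC hα hε hm hP hrep haB hB hx1 hx2
      have hB0 : 0 < B := by linarith
      have hle := userComplexity_le_of (isUserLevelDP_learner P hB0 hε) hU
      have hle' : ((userComplexity (agnostic C α) m ε 0 (2 / 3) : ℕ∞) : ℝ≥0∞) ≤
          ((n : ℕ∞) : ℝ≥0∞) := ENat.toENNReal_le.2 hle
      refine hle'.trans ?_
      have hm0 : (0 : ℝ) < m := by exact_mod_cast hm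
      have hd0 : 0 ≤ d := ENNReal.toReal_nonneg
      rw [hdim, rate_ofReal hd0 hα hε hm, ← ENNReal.ofReal_add (by positivity) (by positivity),
        logFactor, ENNReal.toReal_ofReal (by positivity), ENat.toENNReal_coe,
        ← ENNReal.ofReal_mul (by norm_num), ← ENNReal.ofReal_mul, ← ENNReal.ofReal_natCast]
      · exact ENNReal.ofReal_le_ofReal hn
      · have := one_le_log_three_add
          (t := d / ε + d / (α * ε * √m) + d / (α ^ 2 * m) + 1 / α) (by positivity)
        positivity
  · push Not at hsub
    have hCs : C = {c₁} := Set.eq_singleton_iff_unique_mem.2 ⟨h₁, fun c hc => (hsub c hc).symm⟩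
    rw [hCs, userComplexity_singleton]
    simp

end UpperBound

end UserDP

end

/-! ### The main theorem -/

theorem theoremE3 :
    ∃ (α₀ ε₀ K : ℝ) (k : ℕ), 0 < α₀ ∧ 0 < ε₀ ∧ 0 < K ∧
      ∀ (X : Type*) (C : Set (X → Bool)), C.Nonempty →
      ∀ (α ε : ℝ), 0 < α → α ≤ α₀ → 0 < ε → ε ≤ ε₀ →
      ∀ m : ℕ, 1 ≤ m →
        ((UserDP.userComplexity (UserDP.agnostic C α) m ε 0 (2 / 3) : ℕ∞) : ℝ≥0∞) ≤
          ENNReal.ofReal K *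
            UserDP.logFactor k
              (UserDP.rate (UserDP.prDim C) (UserDP.prDim C) α ε m + ENNReal.ofReal (1 / α)) *
            UserDP.rate (UserDP.prDim C) (UserDP.prDim C) α ε m ∧
        UserDP.rate (UserDP.prDim C) ((UserDP.vcDim C : ℕ∞) : ℝ≥0∞) α ε m ≤
          ENNReal.ofReal K *
            UserDP.logFactor k
              (UserDP.rate (UserDP.prDim C) ((UserDP.vcDim C : ℕ∞) : ℝ≥0∞) α ε m) *
            ((UserDP.userComplexity (UserDP.agnostic C α) m ε 0 (2 / 3) : ℕ∞) : ℝ≥0∞) := by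
  -- `1 / 40` keeps the label bias `20 * α` below 1. Of the three logarithms, one comes from the
  -- boosting rounds and two from `B ^ 2`.
  refine ⟨1 / 40, 1, 10 ^ 9, 3, by norm_num, by norm_num, by norm_num, ?_⟩
  intro X C hC α ε hα hα1 hε hε1 m hm
  refine ⟨UserDP.userComplexity_le_rate hC hα hα1 hε hε1 hm,
    (UserDP.rate_le_userComplexity hC hα hα1 hε hε1 hm).trans (mul_le_mul_left ?_ _)⟩
  calc ENNReal.ofReal 81283 ≤ ENNReal.ofReal (10 ^ 9) := ENNReal.ofReal_le_ofReal (by norm_num)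
    _ ≤ _ := le_mul_of_one_le_right zero_le (UserDP.one_le_logFactor _ _)
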